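/- **Setting.** There are $n\ge 1$ agents with nonnegative values per item $v_i$ and nonnegative budgets $b_i$, and $m$ identical items, $4\mid m$. An adversary fixes the pairs $(v_i,b_i)$ and $n$ time frames $[\alpha_s,\beta_s]$ with $\alpha_1<\dots<\alpha_n$, $\alpha_s\le \beta_s$; the time frames are then matched to the agents by a uniformly random permutation. All agents report truthfully. For a set $S$ of agents and $k\ge 0$, let $$R(S,k,p)=\min\Big(\sum_{i\in S,\,v_i\ge p}\tfrac{b_i}{p},\,k\Big)\,p ,\qquad OPT(S,k)=\max_{p>0}R(S,k,p),\qquad \epsilon(S,k)=\frac{\max_{i\in S}b_i}{OPT(S,k)},$$ and for each $S$ let $\mathcal P(S)>0$ be a maximizer of $R(S,\tfrac m4,\cdot)$ (any fixed choice of maximizers). **$\mathrm{Indiv\_Alloc}(S,p,k)$.** Start with $k'=k$ and $x=\tilde x=0$, and process the agents of $S$ in a uniformly random order. For an agent $i$ with $v_i\ge p$: if $k'\le b_i/p$, set $x_i=\tilde x_i=k'$; otherwise set $\tilde x_i=b_i/p$ and let $x_i$ be $\lceil b_i/p\rceil$ with probability $b_i/p-\lfloor b_i/p\rfloor$ and $\lfloor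 b_i/p\rfloor$ with the remaining probability, independently; then replace $k'$ by $k'-x_i$. Return $(x,\tilde x)$. **$\mathrm{Rev\_Indiv}(N,m)$.** Toss $n-1$ fair coins. Let $A$ be the set of the first $1+\#\text{tails}$ agents to arrive, let $j$ (the pivot agent) be the last of them, let $t_0$ be her arrival time, and let $B=N\setminus A$. Split $A$ into $A_1,A_2$ by fair coins, where the parts are named so that $j\in A_2$. Let $(x,\tilde x)=\mathrm{Indiv\_Alloc}(A_1,\mathcal P(A_2),\tfrac m4)$ and $(x',\tilde x')=\mathrm{Indiv\_Alloc}(A_2,\mathcal P(A_1),\tfrac m4)$. Each $i\in A_1$ who has not departed before $t_0$ gets $x_i$ items and pays $\tilde x_i\,\mathcal P(A_2)$; each $i\in A_2$ who has not departed before $t_0$ gets $x'_i$ items and pays $\tilde x'_i\,\mathcal P(A_1)$. Then set $m_1=m_2=\tfrac m4$ and handle each $i\in B$ upon arrival, tossing a fair coin. On heads ($i\in B_1$), let $(x',\tilde x')$ be the result of a fresh run of $\mathrm{Indiv\_Alloc}(A_1\cup\{i\},\mathcal P(A_2\setminus\{j\}),\tfrac m4)$; agent $i$ gets $\min(x'_i,m_1)$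 items, pays $\min(\tilde x'_i,m_1)\,\mathcal P(A_2\setminus\{j\})$, and $m_1$ decreases by the number of items she got. On tails ($i\in B_2$), do the same with $\mathrm{Indiv\_Alloc}((A_2\cup\{i\})\setminus\{j\},\mathcal P(A_1),\tfrac m4)$, the price $\mathcal P(A_1)$ and $m_2$. The revenue is the sum of all payments. **Lemma.** Let $j$ be an agent, $OPT'=OPT(N\setminus\{j\},m)$ and $\epsilon'=\epsilon(N\setminus\{j\},m)$, and suppose $OPT'>0$. Then for every $\delta\in[0,\tfrac13]$, conditionally on $j$ being the pivot agent, the probability, over the arrival order and the coins that determine $A_1,A_2,B_1,B_2$, that the expected revenue of $\mathrm{Rev\_Indiv}(N,m)$ (expectation over the remaining randomness, namely that of the runs of $\mathrm{Indiv\_Alloc}$) is greater than $\frac{(1-3\delta)\,OPT'}{16}$ is at least $$\max\!\big(0,\,1-2e^{-1/(16\epsilon')}\big)\cdot\max\!\big(0,\,1-4e^{-\delta^2/(16\epsilon')}\big).$$ -/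

import Mathlib

open scoped ENNReal

noncomputable section

namespace OnlineBudget

/-! ### Optimal uniform-price revenue

An agent `i : ι` has a value `v i` per item and a budget `b i`. -/

/-- Revenue `min(∑_{i ∈ S, v_i ≥ p} b_i / p, k) · p` of selling at most `k` items to the agents
of `S` at the uniform price `p`. -/
def uniformRevenue {ι : Type} (v b : ι → ℝ) (S : Finset ι) (k p : ℝ) : ℝ :=
  min (∑ i ∈ S with p ≤ v i, b i / p) k * p

/-- `OPT(S,k)`: the optimal revenue of selling at most `k` items to `S` at a uniform price. -/
def OPT {ι : Type} (v b : ι → ℝ) (S : Finset ι) (k : ℝ) : ℝ :=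
  sSup (uniformRevenue v b S k '' Set.Ioi 0)

/-- `p` is an optimal uniform price, `p ∈ argmax_{p > 0} uniformRevenue v b S k p`. -/
def IsOptPrice {ι : Type} (v b : ι → ℝ) (S : Finset ι) (k p : ℝ) : Prop :=
  0 < p ∧ ∀ q : ℝ, 0 < q → uniformRevenue v b S k q ≤ uniformRevenue v b S k p

/-- The largest budget in `S`. -/
def maxBudget {ι : Type} (b : ι → ℝ) (S : Finset ι) : ℝ :=
  sSup (b '' (S : Set ι))

/-- The market size parameter `ε(S,k)`: the largest budget in `S` divided by `OPT(S,k)`. -/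
def marketEps {ι : Type} (v b : ι → ℝ) (S : Finset ι) (k : ℝ) : ℝ :=
  maxBudget b S / OPT v b S k

/-- For nonnegative budgets and `k ≥ 0` an optimal price exists, and it attains `OPT`. -/
theorem exists_isOptPrice {ι : Type} (v b : ι → ℝ) (hb : ∀ i, 0 ≤ b i) (S : Finset ι)
    (k : ℝ) (hk : 0 ≤ k) :
    ∃ p : ℝ, IsOptPrice v b S k p ∧ uniformRevenue v b S k p = OPT v b S k := by
  classical
  have key : ∃ p : ℝ, IsOptPrice v b S k p := by
    obtain ⟨p, hp, hmax⟩ := Finset.exists_max_image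
      (insert (1 : ℝ) ((S.image v).filter (fun x => 0 < x))) (uniformRevenue v b S k) (by simp)
    have hp0 : 0 < p := by
      rcases Finset.mem_insert.1 hp with h | h
      · rw [h]; exact one_pos
      · exact (Finset.mem_filter.1 h).2
    refine ⟨p, hp0, fun q hq => ?_⟩
    by_cases hT : (S.filter (fun i => q ≤ v i)).Nonempty
    · obtain ⟨i, hi, hmin⟩ := Finset.exists_min_image _ v hT
      have hi' := Finset.mem_filter.1 hi
      have hvi : 0 < v i := lt_of_lt_of_le hq hi'.2
      refine le_trans ?_ (hmax (v i) (by
        refine Finset.mem_insert_of_mem (Finset.mem_filter.2 ⟨?_, hvi⟩)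
        exact Finset.mem_image_of_mem v hi'.1))
      have hS : S.filter (fun l => q ≤ v l) = S.filter (fun l => v i ≤ v l) := by
        ext l
        simp only [Finset.mem_filter]
        constructor
        · rintro ⟨h1, h2⟩
          exact ⟨h1, hmin l (Finset.mem_filter.2 ⟨h1, h2⟩)⟩
        · rintro ⟨h1, h2⟩
          exact ⟨h1, hi'.2.trans h2⟩
      unfold uniformRevenue
      rw [hS, min_mul_of_nonneg _ _ hq.le, min_mul_of_nonneg _ _ hvi.le,
        ← Finset.sum_div, ← Finset.sum_div, div_mul_cancel₀ _ hq.ne', div_mul_cancel₀ _ hvi.ne']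
      exact min_le_min le_rfl (mul_le_mul_of_nonneg_left hi'.2 hk)
    · rw [Finset.not_nonempty_iff_eq_empty] at hT
      have h0 : uniformRevenue v b S k q = 0 := by
        unfold uniformRevenue
        rw [hT]
        simp [hk]
      rw [h0]
      exact mul_nonneg (le_min (Finset.sum_nonneg fun l _ => div_nonneg (hb l) hp0.le) hk) hp0.le
  obtain ⟨p, hp⟩ := key
  refine ⟨p, hp, ?_⟩
  have : IsGreatest (uniformRevenue v b S k '' Set.Ioi 0) (uniformRevenue v b S k p) :=
    ⟨⟨p, hp.1, rfl⟩, by rintro _ ⟨q, hq, rfl⟩; exact hp.2 q hq⟩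
  exact this.csSup_eq.symm

/-! ### Allocation of indivisible items at a fixed price -/

/-- Randomized rounding: `⌈r⌉` with probability `r - ⌊r⌋` and `⌊r⌋` with probability
`1 - r + ⌊r⌋`. -/
def randRound (r : ℝ) : PMF ℝ :=
  (PMF.ofFintype (fun c : Bool => bif c then ENNReal.ofReal (Int.fract r)
      else ENNReal.ofReal (1 - Int.fract r)) (by
    rw [Fintype.sum_bool]
    simp only [cond_true, cond_false]
    rw [← ENNReal.ofReal_add (Int.fract_nonneg r) (by linarith [Int.fract_lt_one r])]
    simp)).map (fun c : Bool => bif c then (⌈r⌉ : ℝ) else (⌊r⌋ : ℝ))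

/-- State of the allocation procedure: items left `k'`, actual allocation `x`, and the
allocation `xt` that is used for charging. -/
structure AllocState (ι : Type) where
  left : ℝ
  x : ι → ℝ
  xt : ι → ℝ

/-- Processing of one agent `i` by `Indiv_Alloc` at price `p`. -/
def indivStep {ι : Type} [DecidableEq ι] (v b : ι → ℝ) (p : ℝ) (s : AllocState ι) (i : ι) :
    PMF (AllocState ι) :=
  open Classical in
  if p ≤ v i then
    if s.left ≤ b i / p then
      pure ⟨s.left - s.left, Function.update s.x i s.left, Function.update s.xt i s.left⟩
    else
      randRound (b i / p) >>= fun r =>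
        pure ⟨s.left - r, Function.update s.x i r, Function.update s.xt i (b i / p)⟩
  else pure s

/-- A uniformly random ordering of the finite set `S`. -/
def randomOrder {ι : Type} (S : Finset ι) : PMF (List ι) :=
  haveI : DecidableEq ι := Classical.decEq ι
  haveI : Nonempty (Fin S.card ≃ S) := ⟨S.equivFin.symm⟩
  (PMF.uniformOfFintype (Fin S.card ≃ S)).map (fun σ => List.ofFn fun t => (σ t : ι))

/-- `Indiv_Alloc(S,p,k)`: the agents of `S` are processed in a uniformly random order. The
result is the (random) pair `(x, x̃)` of actual and charged allocations. -/
def indivAlloc {ι : Type} [DecidableEq ι] (v b : ι → ℝ) (S : Finset ι) (p k : ℝ) :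
    PMF ((ι → ℝ) × (ι → ℝ)) :=
  randomOrder S >>= fun l =>
    l.foldlM (indivStep v b p) ⟨k, fun _ => 0, fun _ => 0⟩ >>= fun s => pure (s.x, s.xt)

/-! ### The online random sampling mechanism

There are `n + 1` agents, named by the index of their (value, budget) pair, and `n + 1` time
frames `[a s, d s]`, `s : Fin (n + 1)`, with increasing arrival times. -/

/-- The random arrival order together with the fair coins that determine the partition:
`order s` is the agent who gets time frame `s`; `coin` are the `n` tosses (`false` = tails)
that determine the length of the sampling phase; `side s` is the coin of the agent in time
frame `s` (`true` = part 1, `false` = part 2). -/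
structure Draw (n : ℕ) where
  order : Equiv.Perm (Fin (n + 1))
  coin : Fin n → Bool
  side : Fin (n + 1) → Bool

/-- A draw is just the triple of its components. -/
def Draw.equivProd (n : ℕ) :
    Draw n ≃ Equiv.Perm (Fin (n + 1)) × (Fin n → Bool) × (Fin (n + 1) → Bool) where
  toFun D := (D.order, D.coin, D.side)
  invFun t := ⟨t.1, t.2.1, t.2.2⟩
  left_inv _ := rfl
  right_inv _ := rfl

instance (n : ℕ) : Fintype (Draw n) := Fintype.ofEquiv _ (Draw.equivProd n).symm

instance (n : ℕ) : Nonempty (Draw n) := (Draw.equivProd n).nonempty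

instance (n : ℕ) : MeasurableSpace (Draw n) := ⊤

/-- The arrival order is uniformly random and all coins are fair and independent. -/
def drawLaw (n : ℕ) : MeasureTheory.Measure (Draw n) :=
  (PMF.uniformOfFintype (Draw n)).toMeasure

namespace Draw

variable {n : ℕ}

/-- The time frame of the pivot agent: the number of tails (time frames are counted from `0`),
so that `A` consists of the first (number of tails) `+ 1` agents. -/
def pivotSlot (D : Draw n) : Fin (n + 1) :=
  ⟨(Finset.univ.filter fun l : Fin n => D.coin l = false).card,
    Nat.lt_succ_of_le ((Finset.card_le_univ _).trans (Fintype.card_fin n).le)⟩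

/-- The pivot agent, i.e. the last agent of the sampling set `A`. -/
def pivot (D : Draw n) : Fin (n + 1) := D.order D.pivotSlot

/-- The part `A₁` of the sampling set. -/
def A₁ (D : Draw n) : Finset (Fin (n + 1)) :=
  (Finset.univ.filter fun s => s < D.pivotSlot ∧ D.side s = true).image D.order

/-- The part `A₂` of the sampling set; by convention it contains the pivot agent. -/
def A₂ (D : Draw n) : Finset (Fin (n + 1)) :=
  insert D.pivot
    ((Finset.univ.filter fun s => s < D.pivotSlot ∧ D.side s = false).image D.order)

/-- The time frames of the agents of `B`, in order of arrival. -/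
def laterSlots (D : Draw n) : List (Fin (n + 1)) :=
  (List.finRange (n + 1)).filter fun s => D.pivotSlot < s

end Draw

/-- Outcome of the mechanism: items allocated to and payment charged from every agent. -/
structure Outcome (ι : Type) where
  alloc : ι → ℝ
  pay : ι → ℝ

/-- State of the revenue collection phase: supplies left for `B₁` and `B₂`, outcome so far. -/
structure CollectState (ι : Type) where
  m₁ : ℝ
  m₂ : ℝ
  out : Outcome ι

/-- Sampling phase. An agent of `A` who is still present at the arrival time `t₀` of the pivot
agent gets her items and pays; agents who have departed get and pay nothing. -/
def samplingPhase {n : ℕ} (d a : Fin (n + 1) → ℝ) (m : ℝ) (P : Finset (Fin (n + 1)) → ℝ)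
    (Alloc : Finset (Fin (n + 1)) → ℝ → ℝ → PMF ((Fin (n + 1) → ℝ) × (Fin (n + 1) → ℝ)))
    (D : Draw n) : PMF (Outcome (Fin (n + 1))) :=
  open Classical in
  Alloc D.A₁ (P D.A₂) (m / 4) >>= fun y =>
  Alloc D.A₂ (P D.A₁) (m / 4) >>= fun z =>
    let present : Fin (n + 1) → Prop := fun i => a D.pivotSlot ≤ d (D.order.symm i)
    pure
      { alloc := fun i =>
          if i ∈ D.A₁ ∧ present i then y.1 i
          else if i ∈ D.A₂ ∧ present i then z.1 i else 0
        pay := fun i =>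
          if i ∈ D.A₁ ∧ present i then y.2 i * P D.A₂
          else if i ∈ D.A₂ ∧ present i then z.2 i * P D.A₁ else 0 }

/-- Revenue collection phase: processing of the agent in time frame `s`. -/
def collectStep {n : ℕ} (m : ℝ) (P : Finset (Fin (n + 1)) → ℝ)
    (Alloc : Finset (Fin (n + 1)) → ℝ → ℝ → PMF ((Fin (n + 1) → ℝ) × (Fin (n + 1) → ℝ)))
    (D : Draw n) (c : CollectState (Fin (n + 1))) (s : Fin (n + 1)) :
    PMF (CollectState (Fin (n + 1))) :=
  let i := D.order s
  if D.side s = true then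
    Alloc (insert i D.A₁) (P (D.A₂.erase D.pivot)) (m / 4) >>= fun y =>
      pure
        { m₁ := c.m₁ - min (y.1 i) c.m₁
          m₂ := c.m₂
          out :=
            { alloc := Function.update c.out.alloc i (min (y.1 i) c.m₁)
              pay := Function.update c.out.pay i
                (min (y.2 i) c.m₁ * P (D.A₂.erase D.pivot)) } }
  else
    Alloc ((insert i D.A₂).erase D.pivot) (P D.A₁) (m / 4) >>= fun y =>
      pure
        { m₁ := c.m₁
          m₂ := c.m₂ - min (y.1 i) c.m₂
          out :=
            { alloc := Function.update c.out.alloc i (min (y.1 i) c.m₂)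
              pay := Function.update c.out.pay i (min (y.2 i) c.m₂ * P D.A₁) } }

/-- `RS_Online(N, m, P, Alloc)` with truthful reports, for a given arrival order and given
partition coins `D`; the remaining randomness is that of the calls of `Alloc`. -/
def rsOnline {n : ℕ} (a d : Fin (n + 1) → ℝ) (m : ℝ) (P : Finset (Fin (n + 1)) → ℝ)
    (Alloc : Finset (Fin (n + 1)) → ℝ → ℝ → PMF ((Fin (n + 1) → ℝ) × (Fin (n + 1) → ℝ)))
    (D : Draw n) : PMF (Outcome (Fin (n + 1))) :=
  samplingPhase d a m P Alloc D >>= fun o =>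
    D.laterSlots.foldlM (collectStep m P Alloc D) ⟨m / 4, m / 4, o⟩ >>= fun c => pure c.out

/-- `Rev_Indiv(N, m)` for the price function `P` and a given draw `D`. -/
def revIndiv {n : ℕ} (a d v b : Fin (n + 1) → ℝ) (m : ℝ) (P : Finset (Fin (n + 1)) → ℝ)
    (D : Draw n) : PMF (Outcome (Fin (n + 1))) :=
  rsOnline a d m P (indivAlloc v b) D

/-- Expected total payment of a random outcome (total payments are nonnegative). -/
def expectedRevenue {ι : Type} [Fintype ι] (μ : PMF (Outcome ι)) : ℝ≥0∞ :=
  ∑' o, μ o * ENNReal.ofReal (∑ i, o.pay i)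

end OnlineBudget

end

/-! Put `K = m / 4`. Only the revenue from the later agents of one well-chosen side is counted. The
payments of the sampling phase and of the other side enter through nonnegativity alone.

For a fixed draw, a later agent on side `τ` faces the price `p` computed from the opposite sample,
and in her fresh run of `indivAlloc` she competes only with the sample of side `τ` (pivot excluded).
If `r` is her demand and `Q ≥ K` bounds the demand of that sample, then out of a residual supply `M`
she buys on average at least `M * r / (2 * Q)` (`le_expect_indivAlloc`). Randomized rounding keeps
the mean payment equal to the price times the mean number of items given away, even after
truncation, because supplies are integers. The unsold part of the supply thus shrinks by a factor `1
- r / (2 * Q)` per agent, and the side earns at least `p * K * (1 - exp (-β / (2 * Q)))`, where `β`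
is the later demand and both `β` and `Q` are now measured in money (`le_expectedRevenue`).

Given the pivot `j`, the other agents fall independently and uniformly into four classes, sampled or
later on side 1 or 2, because a binomial cutoff in a uniform order selects a uniform subset
(`card_draws_mul_card_colourings`). Two kinds of event are needed, each on both sides. First, the
budgets of the agents other than `j` who can afford an optimal price `q` are scaled down to weights
`c` of total `OPT'`; a Chernoff bound gives each sample weight more than `g = OPT' / 4 - 3 * δ *
OPT' / 16`. Selling to a sample at price `q` then earns at least `g`, so its own optimal price `p`
satisfies `g ≤ p * K` and attracts demand at least `g`. Second, the price offered on a side depends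
only on the opposite sample, so the sampled minus the later demand at that price is a sum of fair
signs, controlled by Hoeffding's inequality. Each of the four failures has probability at most `exp
(-δ ^ 2 / (16 * ε'))` (`le_card_balanced`), which gives the second factor of the bound. The first
factor is at most 1 and can be dropped.

The side to count is the one that faces the lower of the two prices: its sampled demand there is at
least its demand at its own optimal price, hence at least `g`, and its later demand is almost as
large. The remaining inequality between real numbers is `revenue_bound_of_balanced`. -/

noncomputable section

namespace OnlineBudget

/-! ### Expectation of `ℝ≥0∞`-valued functions -/

/-- Expectation of `f` under `μ`. -/
def expect {α : Type} (μ : PMF α) (f : α → ℝ≥0∞) : ℝ≥0∞ := ∑' x, μ x * f x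

theorem expect_bind {α β : Type} (μ : PMF α) (κ : α → PMF β) (f : β → ℝ≥0∞) :
    expect (μ >>= κ) f = expect μ fun x => expect (κ x) f := by
  change ∑' y, (μ.bind κ) y * f y = ∑' x, μ x * ∑' y, κ x y * f y
  simp_rw [PMF.bind_apply, ← ENNReal.tsum_mul_right, ← ENNReal.tsum_mul_left]
  rw [ENNReal.tsum_comm]
  simp_rw [mul_assoc]

theorem expect_pure {α : Type} (a : α) (f : α → ℝ≥0∞) : expect (pure a) f = f a := by
  change ∑' x, (PMF.pure a) x * f x = f a
  rw [tsum_eq_single a]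
  · simp
  · intro x hx
    simp [PMF.pure_apply, hx]

theorem expect_map {α β : Type} (μ : PMF α) (g : α → β) (f : β → ℝ≥0∞) :
    expect (μ.map g) f = expect μ fun x => f (g x) := by
  have : μ.map g = μ >>= fun x => pure (g x) := rfl
  rw [this, expect_bind]
  simp_rw [expect_pure]

theorem expect_const {α : Type} (μ : PMF α) (c : ℝ≥0∞) : expect μ (fun _ => c) = c := by
  unfold expect
  rw [ENNReal.tsum_mul_right, PMF.tsum_coe, one_mul]

theorem expect_mono {α : Type} (μ : PMF α) {f g : α → ℝ≥0∞}
    (h : ∀ x ∈ μ.support, f x ≤ g x) : expect μ f ≤ expect μ g := by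
  refine ENNReal.tsum_le_tsum fun x => ?_
  by_cases hx : x ∈ μ.support
  · gcongr
    exact h x hx
  · rw [(PMF.apply_eq_zero_iff μ x).2 hx]
    simp

theorem le_expect {α : Type} (μ : PMF α) {f : α → ℝ≥0∞} {c : ℝ≥0∞}
    (h : ∀ x ∈ μ.support, c ≤ f x) : c ≤ expect μ f :=
  (expect_const μ c).symm.le.trans (expect_mono μ h)

theorem expect_uniformOfFintype {α : Type} [Fintype α] [Nonempty α] (f : α → ℝ≥0∞) :
    expect (PMF.uniformOfFintype α) f = (∑ x, f x) / (Fintype.card α : ℝ≥0∞) := by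
  unfold expect
  rw [tsum_fintype]
  simp_rw [PMF.uniformOfFintype_apply]
  rw [← Finset.mul_sum, mul_comm, ENNReal.div_eq_inv_mul, mul_comm]

/-- The pointwise bounds `g` may be negative. Truncation by `ENNReal.ofReal` only raises them, so
averages can be computed over `ℝ`. -/
theorem ofReal_average_le_expect {α : Type} [Fintype α] [Nonempty α] (g : α → ℝ)
    (f : α → ℝ≥0∞) (hf : ∀ x, ENNReal.ofReal (g x) ≤ f x) (c : ℝ)
    (hc : c * Fintype.card α ≤ ∑ x, g x) :
    ENNReal.ofReal c ≤ expect (PMF.uniformOfFintype α) f := by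
  rw [expect_uniformOfFintype]
  rw [ENNReal.le_div_iff_mul_le (Or.inl (by simp)) (Or.inl (by simp))]
  have h1 : ENNReal.ofReal c * (Fintype.card α : ℝ≥0∞)
      = ENNReal.ofReal (c * Fintype.card α) := by
    rw [ENNReal.ofReal_mul' (by positivity), ENNReal.ofReal_natCast]
  rw [h1]
  calc ENNReal.ofReal (c * Fintype.card α) ≤ ENNReal.ofReal (∑ x, max 0 (g x)) :=
        ENNReal.ofReal_le_ofReal (hc.trans (Finset.sum_le_sum fun x _ => le_max_right _ _))
    _ = ∑ x, ENNReal.ofReal (max 0 (g x)) :=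
        ENNReal.ofReal_sum_of_nonneg fun x _ => le_max_left _ _
    _ ≤ ∑ x, f x := Finset.sum_le_sum fun x _ => by
        refine le_trans ?_ (hf x)
        rw [ENNReal.ofReal_max]
        simp

/-! ### Randomized rounding -/

theorem expect_randRound (r : ℝ) (f : ℝ → ℝ≥0∞) :
    expect (randRound r) f = ENNReal.ofReal (Int.fract r) * f ⌈r⌉
      + ENNReal.ofReal (1 - Int.fract r) * f ⌊r⌋ := by
  unfold randRound
  rw [expect_map]
  unfold expect
  rw [tsum_fintype, Fintype.sum_bool]
  simp [PMF.ofFintype_apply]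

/-- Jensen's inequality for the two-point distribution `randRound r`. -/
theorem ofReal_le_expect_randRound (r : ℝ) (f : ℝ → ℝ≥0∞) (g : ℝ → ℝ) (c : ℝ)
    (h₁ : ENNReal.ofReal (g ⌈r⌉) ≤ f ⌈r⌉) (h₂ : ENNReal.ofReal (g ⌊r⌋) ≤ f ⌊r⌋)
    (hc : c ≤ Int.fract r * g ⌈r⌉ + (1 - Int.fract r) * g ⌊r⌋) :
    ENNReal.ofReal c ≤ expect (randRound r) f := by
  rw [expect_randRound]
  have hf0 := Int.fract_nonneg r
  have hf1 : 0 ≤ 1 - Int.fract r := by linarith [Int.fract_lt_one r]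
  calc ENNReal.ofReal c ≤ ENNReal.ofReal (Int.fract r * g ⌈r⌉ + (1 - Int.fract r) * g ⌊r⌋) :=
        ENNReal.ofReal_le_ofReal hc
    _ ≤ ENNReal.ofReal (Int.fract r * g ⌈r⌉) + ENNReal.ofReal ((1 - Int.fract r) * g ⌊r⌋) :=
        ENNReal.ofReal_add_le
    _ = ENNReal.ofReal (Int.fract r) * ENNReal.ofReal (g ⌈r⌉)
        + ENNReal.ofReal (1 - Int.fract r) * ENNReal.ofReal (g ⌊r⌋) := by
        rw [ENNReal.ofReal_mul hf0, ENNReal.ofReal_mul hf1]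
    _ ≤ _ := by gcongr

theorem fract_mul_ceil_add (r : ℝ) :
    Int.fract r * ⌈r⌉ + (1 - Int.fract r) * ⌊r⌋ = r := by
  by_cases h : Int.fract r = 0
  · rw [h]
    have := Int.floor_add_fract r
    rw [h] at this
    linarith
  · have h1 : ⌈r⌉ = ⌊r⌋ + 1 := by
      have hpos : 0 < Int.fract r := lt_of_le_of_ne (Int.fract_nonneg r) (Ne.symm h)
      rw [Int.ceil_eq_iff]
      push_cast
      have h2 := Int.floor_add_fract r
      have h3 := Int.fract_lt_one r
      constructor <;> linarith
    rw [h1]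
    push_cast
    have := Int.floor_add_fract r
    linarith

/-- Truncation at an integer commutes with taking the mean of a randomized rounding. -/
theorem fract_mul_min_ceil_add (r : ℝ) (M : ℕ) :
    Int.fract r * min (⌈r⌉ : ℝ) M + (1 - Int.fract r) * min (⌊r⌋ : ℝ) M = min r M := by
  -- An integer `M` never lies strictly between `⌊r⌋` and `⌈r⌉`, so truncation at `M` is affine on
  -- that interval.
  rcases le_or_gt r M with h | h
  · have h1 : (⌈r⌉ : ℝ) ≤ M := by exact_mod_cast Int.ceil_le.2 (by exact_mod_cast h)
    rw [min_eq_left h1, min_eq_left ((Int.floor_le r).trans h), min_eq_left h,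
      fract_mul_ceil_add]
  · have h1 : (M : ℝ) ≤ ⌊r⌋ := by
      exact_mod_cast Int.le_floor.2 (by exact_mod_cast h.le)
    rw [min_eq_right h1, min_eq_right (h.le.trans (Int.le_ceil r)), min_eq_right h.le]
    ring

/-! ### The allocation procedure for a fixed order -/

/-- The number of items agent `i` demands at price `p`. -/
def demand {ι : Type} (v b : ι → ℝ) (p : ℝ) (i : ι) : ℝ :=
  open Classical in if p ≤ v i then b i / p else 0

theorem demand_nonneg {ι : Type} {v b : ι → ℝ} (hb : ∀ i, 0 ≤ b i) {p : ℝ} (hp : 0 < p) (i : ι) :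
    0 ≤ demand v b p i := by
  unfold demand
  split_ifs
  · exact div_nonneg (hb i) hp.le
  · exact le_rfl

section Fold

variable {ι : Type} [DecidableEq ι]

/-- Allocations are natural numbers and charged allocations are nonnegative. -/
structure AllocState.Valid (s : AllocState ι) : Prop where
  left : ∃ k : ℕ, s.left = k
  x : ∀ i, ∃ k : ℕ, s.x i = k
  xt : ∀ i, 0 ≤ s.xt i

theorem indivStep_valid {v b : ι → ℝ} (hb : ∀ i, 0 ≤ b i) {p : ℝ} (hp : 0 < p)
    {s : AllocState ι} (hs : s.Valid) (i : ι) :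
    ∀ t ∈ (indivStep v b p s i).support, t.Valid := by
  intro t ht
  obtain ⟨⟨k, hk⟩, hx, hxt⟩ := hs
  unfold indivStep at ht
  have hr0 : 0 ≤ b i / p := div_nonneg (hb i) hp.le
  have key : ∀ (r c : ℝ) (q : ℕ), r = q → 0 ≤ c →
      (∀ l, ∃ k : ℕ, Function.update s.x i r l = k) ∧ ∀ l, 0 ≤ Function.update s.xt i c l := by
    intro r c q hr hc
    refine ⟨fun l => ?_, fun l => ?_⟩ <;> by_cases hl : l = i
    · subst hl; exact ⟨q, by simp [hr]⟩
    · simpa [hl] using hx l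
    · subst hl; simpa using hc
    · simpa [hl] using hxt l
  split_ifs at ht with h1 h2
  · have ht' : t = _ := (PMF.mem_support_pure_iff _ _).1 ht
    subst ht'
    have := key s.left s.left k hk (by rw [hk]; positivity)
    exact ⟨⟨0, by simp⟩, this.1, this.2⟩
  · obtain ⟨r, hr, ht'⟩ := (PMF.mem_support_bind_iff _ _ _).1 ht
    have ht'' : t = _ := (PMF.mem_support_pure_iff _ _).1 ht'
    subst ht''
    push Not at h2
    rw [hk] at h2
    have : ∃ q : ℕ, r = q ∧ q ≤ k := by
      unfold randRound at hr
      obtain ⟨c, -, hc⟩ := (PMF.mem_support_map_iff _ _ _).1 hr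
      have h3 : (0 : ℤ) ≤ ⌊b i / p⌋ := Int.floor_nonneg.2 hr0
      have h5 : ⌈b i / p⌉ ≤ (k : ℤ) := Int.ceil_le.2 (by exact_mod_cast h2.le)
      have h4 := Int.floor_le_ceil (b i / p)
      cases c
      · refine ⟨⌊b i / p⌋.toNat, ?_, by omega⟩
        rw [← hc]
        simp only [cond_false]
        exact_mod_cast (Int.toNat_of_nonneg h3).symm
      · refine ⟨⌈b i / p⌉.toNat, ?_, by omega⟩
        rw [← hc]
        simp only [cond_true]
        exact_mod_cast (Int.toNat_of_nonneg (h3.trans h4)).symm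
    obtain ⟨q, hq, hqk⟩ := this
    have := key r (b i / p) q hq hr0
    exact ⟨⟨k - q, by simp [hk, hq, Nat.cast_sub hqk]⟩, this.1, this.2⟩
  · have ht' : t = s := (PMF.mem_support_pure_iff _ _).1 ht
    subst ht'
    exact ⟨⟨k, hk⟩, hx, hxt⟩

theorem foldlM_indivStep_valid {v b : ι → ℝ} (hb : ∀ i, 0 ≤ b i) {p : ℝ} (hp : 0 < p)
    (l : List ι) : ∀ {s : AllocState ι}, s.Valid →
    ∀ t ∈ (l.foldlM (indivStep v b p) s).support, t.Valid := by
  induction l with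
  | nil =>
    intro s hs t ht
    have ht' : t = s := (PMF.mem_support_pure_iff _ _).1 ht
    exact ht' ▸ hs
  | cons i l ih =>
    intro s hs t ht
    rw [List.foldlM_cons] at ht
    obtain ⟨u, hu, ht⟩ := (PMF.mem_support_bind_iff _ _ _).1 ht
    exact ih (indivStep_valid hb hp hs i u hu) t ht

theorem indivAlloc_support {v b : ι → ℝ} (hb : ∀ i, 0 ≤ b i) {p : ℝ} (hp : 0 < p)
    (S : Finset ι) (K : ℕ) :
    ∀ y ∈ (indivAlloc v b S p K).support, (∀ i, ∃ k : ℕ, y.1 i = k) ∧ ∀ i, 0 ≤ y.2 i := by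
  intro y hy
  unfold indivAlloc at hy
  obtain ⟨l, -, hy⟩ := (PMF.mem_support_bind_iff _ _ _).1 hy
  obtain ⟨s, hs, hy⟩ := (PMF.mem_support_bind_iff _ _ _).1 hy
  have hy' : y = _ := (PMF.mem_support_pure_iff _ _).1 hy
  subst hy'
  have := foldlM_indivStep_valid hb hp l (s := ⟨K, fun _ => 0, fun _ => 0⟩)
    ⟨⟨K, rfl⟩, fun _ => ⟨0, by simp⟩, fun _ => le_rfl⟩ s hs
  exact ⟨this.x, this.xt⟩

theorem expect_indivStep_of_ne (v b : ι → ℝ) (p : ℝ) {i l : ι} (hl : l ≠ i)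
    (s : AllocState ι) (F : ℝ → ℝ → ℝ≥0∞) :
    expect (indivStep v b p s l) (fun t => F (t.x i) (t.xt i)) = F (s.x i) (s.xt i) := by
  unfold indivStep
  split_ifs
  · rw [expect_pure]
    simp [hl.symm]
  · rw [expect_bind]
    simp_rw [expect_pure]
    simp only [ne_eq, hl.symm, not_false_eq_true, Function.update_of_ne, expect_const]
  · rw [expect_pure]

/-- Agents processed after `i` do not touch her entries, so the part of the order behind her can be
discarded. -/
theorem expect_foldlM_indivStep_of_notMem (v b : ι → ℝ) (p : ℝ) {i : ι} (l : List ι)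
    (hl : i ∉ l) (F : ℝ → ℝ → ℝ≥0∞) : ∀ s : AllocState ι,
    expect (l.foldlM (indivStep v b p) s) (fun t => F (t.x i) (t.xt i))
      = F (s.x i) (s.xt i) := by
  induction l with
  | nil => intro s; exact expect_pure _ _
  | cons k l ih =>
    intro s
    rw [List.mem_cons, not_or] at hl
    rw [List.foldlM_cons, expect_bind]
    simp_rw [ih hl.2]
    exact expect_indivStep_of_ne v b p (Ne.symm hl.1) s F

end Fold

theorem exists_nat_ceil_floor {r : ℝ} (hr : 0 ≤ r) {k : ℕ} (hk : r ≤ k) :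
    (∃ q : ℕ, (⌈r⌉ : ℝ) = q ∧ q ≤ k) ∧ ∃ q : ℕ, (⌊r⌋ : ℝ) = q ∧ q ≤ k := by
  have h3 : (0 : ℤ) ≤ ⌊r⌋ := Int.floor_nonneg.2 hr
  have h5 : ⌈r⌉ ≤ (k : ℤ) := Int.ceil_le.2 (by exact_mod_cast hk)
  have h4 := Int.floor_le_ceil r
  refine ⟨⟨⌈r⌉.toNat, ?_, by omega⟩, ⟨⌊r⌋.toNat, ?_, by omega⟩⟩
  · exact_mod_cast (Int.toNat_of_nonneg (h3.trans h4)).symm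
  · exact_mod_cast (Int.toNat_of_nonneg h3).symm

/-- Two of the three factors are bounded by `K` at a time. The bound is linear in the remaining
supply `k`, so it survives averaging over `k`. -/
theorem mul_mul_div_sq_le_min {r k M K : ℝ} (hr : 0 ≤ r) (hk : 0 ≤ k) (hM : 0 ≤ M)
    (hK : 0 < K) (hrK : r ≤ K) (hkK : k ≤ K) (hMK : M ≤ K) :
    r * M / K ^ 2 * k ≤ min r (min k M) := by
  have e : r * M / K ^ 2 * k = (r * M * k) / K ^ 2 := by ring
  rw [e]
  refine le_min ?_ (le_min ?_ ?_) <;> rw [div_le_iff₀ (by positivity)]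
  · nlinarith [mul_le_mul hMK hkK hk hK.le]
  · nlinarith [mul_le_mul hMK hrK hr hK.le]
  · nlinarith [mul_le_mul hrK hkK hk hK.le]

section Fold

variable {ι : Type} [DecidableEq ι]

/-- Processing agent `i` when `k` items are left, at most `M` of which she may receive. -/
theorem le_expect_indivStep_self {v b : ι → ℝ} (hb : ∀ i, 0 ≤ b i) {p : ℝ} (hp : 0 < p)
    {i : ι} {K M : ℕ} (hK : 0 < K) (hM : M ≤ K) (hr : demand v b p i ≤ K)
    {C c : ℝ} (hc : c ≤ 1) (F : ℝ → ℝ → ℝ≥0∞)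
    (hF : ∀ (x : ℕ) (t : ℝ), 0 ≤ t →
      ENNReal.ofReal (C + p * min t M + p * c * (M - min (x : ℝ) M)) ≤ F x t)
    (s : AllocState ι) (k : ℕ) (hk : k ≤ K) (hs : s.left = k) (hsx : s.x i = 0)
    (hst : s.xt i = 0) :
    ENNReal.ofReal (C + p * c * M + p * (1 - c) * (demand v b p i * M / (K : ℝ) ^ 2 * k))
      ≤ expect (indivStep v b p s i) (fun t => F (t.x i) (t.xt i)) := by
  have hK' : (0 : ℝ) < K := by exact_mod_cast hK
  have hM' : (M : ℝ) ≤ K := by exact_mod_cast hM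
  have hk' : (k : ℝ) ≤ K := by exact_mod_cast hk
  have hpc : 0 ≤ p * (1 - c) := mul_nonneg hp.le (by linarith)
  have hmin := mul_mul_div_sq_le_min (demand_nonneg hb hp i) (Nat.cast_nonneg k)
    (Nat.cast_nonneg M) hK' hr hk' hM'
  have hmul := mul_le_mul_of_nonneg_left hmin hpc
  unfold demand at hmul hr ⊢
  unfold indivStep
  split_ifs at hmul hr ⊢ with h1 h2
  -- The agent takes everything that is left, so allocation and charge are both `k` and no rounding
  -- occurs.
  · rw [expect_pure]
    simp only [Function.update_self, hs]
    refine le_trans (ENNReal.ofReal_le_ofReal ?_) (hF k k (Nat.cast_nonneg k))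
    have h3 : min (b i / p) (min (k : ℝ) M) ≤ min (k : ℝ) M := min_le_right _ _
    have h4 := mul_le_mul_of_nonneg_left h3 hpc
    linarith
  · rw [expect_bind]
    simp_rw [expect_pure]
    simp only [Function.update_self]
    push Not at h2
    rw [hs] at h2
    have hr0 : 0 ≤ b i / p := div_nonneg (hb i) hp.le
    obtain ⟨⟨q, hq, -⟩, ⟨q', hq', -⟩⟩ := exists_nat_ceil_floor hr0 h2.le
    refine ofReal_le_expect_randRound (b i / p) _
      (fun x => C + p * min (b i / p) M + p * c * (M - min x M)) _ ?_ ?_ ?_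
    · rw [hq]; exact hF q _ hr0
    · rw [hq']; exact hF q' _ hr0
    · have h3 : min (b i / p) (min (k : ℝ) M) ≤ min (b i / p) M :=
        le_min (min_le_left _ _) ((min_le_right _ _).trans (min_le_right _ _))
      have h4 := mul_le_mul_of_nonneg_left h3 hpc
      -- In the mean `min x M` equals `min (b i / p) M`, so the items sold now gain `p` each and
      -- cost `p * c` each of future revenue.
      have h5 := fract_mul_min_ceil_add (b i / p) M
      have h6 := congrArg (fun z => p * c * z) h5
      linarith
  · rw [expect_pure, hsx, hst]
    simpa [hp.le] using hF 0 0 le_rfl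

/-- Here `C` stands for revenue already secured, `M` for the supply of the collection phase and `c`
for the fraction of it that later agents are known to buy. `F` is the value of continuing, so a
purchase now has net value `p * (1 - c)` per item. The induction runs over the agents ahead of `i`:
rounding preserves the mean supply, and truncation at 0 is convex. -/
theorem le_expect_foldlM_indivStep {v b : ι → ℝ} (hb : ∀ i, 0 ≤ b i) {p : ℝ} (hp : 0 < p)
    {i : ι} {K M : ℕ} (hK : 0 < K) (hM : M ≤ K) (hr : demand v b p i ≤ K)
    {C c : ℝ} (hc : c ≤ 1) (F : ℝ → ℝ → ℝ≥0∞)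
    (hF : ∀ (x : ℕ) (t : ℝ), 0 ≤ t →
      ENNReal.ofReal (C + p * min t M + p * c * (M - min (x : ℝ) M)) ≤ F x t)
    (l₂ : List ι) (hl₂ : i ∉ l₂) (l₁ : List ι) :
    i ∉ l₁ → ∀ (s : AllocState ι) (k : ℕ), k ≤ K → s.left = k → s.x i = 0 → s.xt i = 0 →
    ENNReal.ofReal (C + p * c * M + p * (1 - c) * (demand v b p i * M / (K : ℝ) ^ 2 *
        max 0 (k - (l₁.map (demand v b p)).sum)))
      ≤ expect ((l₁ ++ i :: l₂).foldlM (indivStep v b p) s) (fun t => F (t.x i) (t.xt i)) := by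
  induction l₁ with
  | nil =>
    intro _ s k hk hs hsx hst
    rw [List.nil_append, List.foldlM_cons, expect_bind]
    simp_rw [expect_foldlM_indivStep_of_notMem v b p l₂ hl₂ F]
    have := le_expect_indivStep_self hb hp hK hM hr hc F hF s k hk hs hsx hst
    simpa using this
  | cons l l₁ ih =>
    intro hl s k hk hs hsx hst
    rw [List.mem_cons, not_or] at hl
    rw [List.cons_append, List.foldlM_cons, expect_bind]
    set Φ : AllocState ι → ℝ≥0∞ := fun x =>
      expect (List.foldlM (indivStep v b p) x (l₁ ++ i :: l₂)) fun t => F (t.x i) (t.xt i)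
    set T := (l₁.map (demand v b p)).sum with hT
    set B := p * (1 - c) with hB
    have hB0 : 0 ≤ B := mul_nonneg hp.le (by linarith)
    set B' := demand v b p i * M / (K : ℝ) ^ 2
    have hB'0 : 0 ≤ B' := by
      have := demand_nonneg (v := v) hb hp i
      positivity
    have hT0 : 0 ≤ T := by
      refine List.sum_nonneg fun x hx => ?_
      obtain ⟨y, -, rfl⟩ := List.mem_map.1 hx
      exact demand_nonneg hb hp y
    have mono : ∀ {x y : ℝ}, x ≤ y → C + p * c * M + B * (B' * max 0 x)
        ≤ C + p * c * M + B * (B' * max 0 y) := by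
      intro x y hxy
      gcongr
    rw [List.map_cons, List.sum_cons, ← hT]
    unfold demand indivStep
    split_ifs with h1 h2
    · rw [expect_pure]
      -- Agent `l` exhausts the supply. The induction hypothesis with 0 items suffices because `k ≤
      -- b l / p`.
      refine le_trans (ENNReal.ofReal_le_ofReal (mono ?_))
        (ih hl.2 _ 0 (Nat.zero_le _) (by simp) (by simp [hl.1, hsx]) (by simp [hl.1, hst]))
      rw [hs] at h2
      push_cast
      linarith
    · rw [expect_bind]
      simp_rw [expect_pure]
      push Not at h2
      rw [hs] at h2
      have hr0 : 0 ≤ b l / p := div_nonneg (hb l) hp.le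
      obtain ⟨⟨q, hq, hqk⟩, ⟨q', hq', hqk'⟩⟩ := exists_nat_ceil_floor hr0 h2.le
      refine ofReal_le_expect_randRound (b l / p) _
        (fun x => C + p * c * M + B * (B' * max 0 (k - x - T))) _ ?_ ?_ ?_
      · have := ih hl.2 ⟨s.left - ⌈b l / p⌉, Function.update s.x l ⌈b l / p⌉,
          Function.update s.xt l (b l / p)⟩ (k - q) (by omega)
          (by simp [hs, hq, Nat.cast_sub hqk]) (by simp [hl.1, hsx]) (by simp [hl.1, hst])
        rw [Nat.cast_sub hqk, ← hq] at this
        exact this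
      · have := ih hl.2 ⟨s.left - ⌊b l / p⌋, Function.update s.x l ⌊b l / p⌋,
          Function.update s.xt l (b l / p)⟩ (k - q') (by omega)
          (by simp [hs, hq', Nat.cast_sub hqk']) (by simp [hl.1, hsx]) (by simp [hl.1, hst])
        rw [Nat.cast_sub hqk', ← hq'] at this
        exact this
      · have hf0 := Int.fract_nonneg (b l / p)
        have hf1 : 0 ≤ 1 - Int.fract (b l / p) := by linarith [Int.fract_lt_one (b l / p)]
        have hmean := fract_mul_ceil_add (b l / p)
        set φ := Int.fract (b l / p)
        set u : ℝ := ((⌈b l / p⌉ : ℤ) : ℝ)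
        set w : ℝ := ((⌊b l / p⌋ : ℤ) : ℝ)
        -- Jensen's inequality for `max 0` at the two rounded values, whose mean is `b l / p`.
        have key : max 0 (k - (b l / p + T))
            ≤ φ * max 0 (k - u - T) + (1 - φ) * max 0 (k - w - T) := by
          have a1 := mul_le_mul_of_nonneg_left (le_max_right 0 (k - u - T)) hf0
          have a2 := mul_le_mul_of_nonneg_left (le_max_right 0 (k - w - T)) hf1
          refine max_le (by positivity) ?_
          nlinarith
        have := mul_le_mul_of_nonneg_left (mul_le_mul_of_nonneg_left key hB'0) hB0
        nlinarith
    · rw [expect_pure, zero_add]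
      exact ih hl.2 s k hk hs hsx hst

end Fold

/-! ### Averages over uniformly random orders -/

section Order

variable {α : Type} [Fintype α] [DecidableEq α] {N : ℕ}

theorem sum_equiv_trans (π : Equiv.Perm α) (G : (Fin N ≃ α) → ℝ) :
    ∑ σ : Fin N ≃ α, G (σ.trans π) = ∑ σ : Fin N ≃ α, G σ :=
  Equiv.sum_comp (⟨fun σ => σ.trans π, fun σ => σ.trans π.symm, fun σ => by ext; simp,
    fun σ => by ext; simp⟩ : (Fin N ≃ α) ≃ (Fin N ≃ α)) G

/-- In a uniformly random order the position of an agent is uniform. -/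
theorem card_mul_sum_position (hN : Fintype.card α = N) (g : Fin N → ℝ) (i : α) :
    (N : ℝ) * ∑ σ : Fin N ≃ α, g (σ.symm i)
      = (Fintype.card (Fin N ≃ α) : ℝ) * ∑ s, g s := by
  have h1 : ∀ l : α, ∑ σ : Fin N ≃ α, g (σ.symm l) = ∑ σ : Fin N ≃ α, g (σ.symm i) := by
    intro l
    rw [← sum_equiv_trans (Equiv.swap l i) fun σ : Fin N ≃ α => g (σ.symm i)]
    simp
  calc (N : ℝ) * ∑ σ : Fin N ≃ α, g (σ.symm i)
      = ∑ l : α, ∑ σ : Fin N ≃ α, g (σ.symm l) := by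
        simp_rw [h1]
        rw [Finset.sum_const, Finset.card_univ, hN, nsmul_eq_mul]
    _ = ∑ σ : Fin N ≃ α, ∑ l : α, g (σ.symm l) := Finset.sum_comm
    _ = ∑ σ : Fin N ≃ α, ∑ s, g s :=
        Finset.sum_congr rfl fun σ _ => Equiv.sum_comp σ.symm g
    _ = _ := by rw [Finset.sum_const, Finset.card_univ, nsmul_eq_mul]

theorem sum_lt_position (σ : Fin N ≃ α) (i : α) (w : α → ℝ) :
    ∑ u with u < σ.symm i, w (σ u)
      = ∑ l ∈ Finset.univ.erase i, w l * if σ.symm l < σ.symm i then 1 else 0 := by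
  rw [Finset.sum_subset (Finset.subset_univ (Finset.univ.erase i))
    (f := fun l => w l * if σ.symm l < σ.symm i then 1 else 0), Finset.sum_filter,
    ← Equiv.sum_comp σ fun l => w l * if σ.symm l < σ.symm i then 1 else 0]
  · simp
  · intro l _ hl
    simp only [Finset.mem_erase, Finset.mem_univ, and_true, not_not] at hl
    simp [hl]

/-- Given the position of agent `i`, the agents before her form a uniformly random set. -/
theorem card_sub_one_mul_sum_before (θ : Fin N → ℝ) (i : α) (w : α → ℝ)
    (hN : Fintype.card α = N) :
    ((N : ℝ) - 1) * ∑ σ : Fin N ≃ α, θ (σ.symm i) * ∑ u with u < σ.symm i, w (σ u)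
      = (∑ l ∈ Finset.univ.erase i, w l) *
        ∑ σ : Fin N ≃ α, θ (σ.symm i) * ((σ.symm i : ℕ) : ℝ) := by
  set E := (Finset.univ : Finset α).erase i with hE
  -- The `θ`-weighted number of orders in which `l` precedes `i`. Transposing two agents other than
  -- `i` shows that it does not depend on `l`.
  set q : α → ℝ := fun l =>
    ∑ σ : Fin N ≃ α, θ (σ.symm i) * if σ.symm l < σ.symm i then 1 else 0 with hq
  have hqq : ∀ l ∈ E, ∀ l' ∈ E, q l = q l' := by
    intro l hl l' hl'
    have hl : l ≠ i := Finset.ne_of_mem_erase hl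
    have hl' : l' ≠ i := Finset.ne_of_mem_erase hl'
    simp only [hq]
    rw [← sum_equiv_trans (Equiv.swap l l') fun σ : Fin N ≃ α =>
      θ (σ.symm i) * if σ.symm l' < σ.symm i then (1 : ℝ) else 0]
    simp [Equiv.swap_apply_of_ne_of_ne hl.symm hl'.symm]
  have hcard : ((N : ℝ) - 1) = (E.card : ℝ) := by
    have : E.card + 1 = N := by
      rw [hE, Finset.card_erase_add_one (Finset.mem_univ i), Finset.card_univ, hN]
    rw [← this]
    push_cast
    ring
  have hsum : ∀ w : α → ℝ,
      ∑ σ : Fin N ≃ α, θ (σ.symm i) * ∑ u with u < σ.symm i, w (σ u)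
        = ∑ l ∈ E, w l * q l := by
    intro w
    simp_rw [sum_lt_position, hq, Finset.mul_sum]
    rw [Finset.sum_comm]
    refine Finset.sum_congr rfl fun l _ => Finset.sum_congr rfl fun σ _ => ?_
    ring
  have hcount : ∑ l ∈ E, q l = ∑ σ : Fin N ≃ α, θ (σ.symm i) * ((σ.symm i : ℕ) : ℝ) := by
    have := hsum fun _ => 1
    simp only [one_mul] at this
    rw [← this]
    refine Finset.sum_congr rfl fun σ _ => ?_
    rw [Finset.sum_const, nsmul_eq_mul, mul_one]
    congr 2
    have : (Finset.univ.filter fun u : Fin N => u < σ.symm i) = Finset.Iio (σ.symm i) := by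
      ext; simp
    rw [this, Fin.card_Iio]
  rw [hsum, ← hcount, hcard]
  calc (E.card : ℝ) * ∑ l ∈ E, w l * q l = ∑ l ∈ E, ∑ l' ∈ E, w l * q l' := by
        rw [Finset.mul_sum]
        refine Finset.sum_congr rfl fun l hl => ?_
        rw [Finset.sum_congr rfl fun l' hl' => by rw [hqq l' hl' l hl], Finset.sum_const,
          nsmul_eq_mul]
    _ = _ := by rw [Finset.sum_mul_sum]

/-- The sum is a left Riemann sum for a triangle of height `K` and base `z = K * L / D ≤ L`, whose
area is `L * (K ^ 2 / (2 * D))`. Its excess over the area pays for replacing `L` by `L + 1`. -/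
theorem le_sum_max_zero_sub (L : ℕ) {K D : ℝ} (hK : 0 < K) (hKD : K ≤ D) :
    (L + 1) * (K ^ 2 / (2 * D)) ≤ ∑ s ∈ Finset.range (L + 1), max 0 (K - s * D / L) := by
  have hD : 0 < D := hK.trans_le hKD
  -- For `L = 0` division by zero yields 0, so the single term is `K`.
  rcases Nat.eq_zero_or_pos L with rfl | hL
  · simp only [Nat.cast_zero, zero_add, one_mul, Finset.range_one, Finset.sum_singleton,
      div_zero, sub_zero]
    refine le_max_of_le_right ?_
    rw [div_le_iff₀ (by positivity)]
    nlinarith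
  have hL' : (1 : ℝ) ≤ L := by exact_mod_cast hL
  set z := K * L / D with hz
  have hz0 : 0 ≤ z := by positivity
  have hzL : z ≤ L := by
    rw [hz, div_le_iff₀ hD]
    nlinarith
  set T := ⌊z⌋₊ with hT
  have hTz : (T : ℝ) ≤ z := Nat.floor_le hz0
  have hzT : z < T + 1 := Nat.lt_floor_add_one z
  have hTL : T ≤ L := by exact_mod_cast hTz.trans hzL
  have hid : ∑ s ∈ Finset.range (T + 1), (K - s * D / L)
      = (D / L) * ((T + 1) * (z - T / 2)) := by
    rw [Finset.sum_sub_distrib, Finset.sum_const, Finset.card_range, nsmul_eq_mul]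
    have h2 : ∑ s ∈ Finset.range (T + 1), (s : ℝ) = (T + 1) * T / 2 := by
      have := Finset.sum_range_id_mul_two (T + 1)
      rw [Nat.add_sub_cancel] at this
      have h3 : (∑ s ∈ Finset.range (T + 1), (s : ℝ)) * 2 = (T + 1) * T := by
        have h4 := congrArg (Nat.cast : ℕ → ℝ) this
        push_cast at h4
        exact h4
      linarith
    simp_rw [mul_div_assoc]
    rw [← Finset.sum_mul, h2, hz]
    push_cast
    field_simp
  calc (L + 1) * (K ^ 2 / (2 * D)) = (D / L) * ((L + 1) / (2 * L) * z ^ 2) := by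
        rw [hz]; field_simp
    _ ≤ (D / L) * ((T + 1) * (z - T / 2)) := by
        refine mul_le_mul_of_nonneg_left ?_ (by positivity)
        rw [div_mul_eq_mul_div, div_le_iff₀ (by positivity)]
        have h1 : z ^ 2 ≤ z * L := by nlinarith
        -- This is `0 ≤ (z - T) * (T + 1 - z)` rearranged.
        have h2 : z ≤ (T + 1) * (2 * z - T) - z ^ 2 := by
          nlinarith [mul_nonneg (sub_nonneg.2 hTz) (sub_nonneg.2 hzT.le)]
        nlinarith
    _ = ∑ s ∈ Finset.range (T + 1), (K - s * D / L) := hid.symm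
    _ ≤ ∑ s ∈ Finset.range (T + 1), max 0 (K - s * D / L) :=
        Finset.sum_le_sum fun _ _ => le_max_right _ _
    _ ≤ _ := Finset.sum_le_sum_of_subset_of_nonneg
        (Finset.range_subset_range.2 (by omega)) fun _ _ _ => le_max_left _ _

/-- Lower bound for the mean supply that is left before a given agent in random order. -/
theorem le_sum_max_zero_sub_before (hN : Fintype.card α = N) (i : α) {w : α → ℝ}
    {K D : ℝ} (hK : 0 < K) (hKD : K ≤ D)
    (hD : ∑ l ∈ Finset.univ.erase i, w l ≤ D) :
    (K ^ 2 / (2 * D)) * (Fintype.card (Fin N ≃ α) : ℝ)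
      ≤ ∑ σ : Fin N ≃ α, max 0 (K - ∑ u with u < σ.symm i, w (σ u)) := by
  have hN0 : 0 < N := hN ▸ Fintype.card_pos_iff.2 ⟨i⟩
  obtain ⟨L, rfl⟩ : ∃ L, N = L + 1 := ⟨N - 1, by omega⟩
  set f : Fin (L + 1) → ℝ := fun s => max 0 (K - (s : ℕ) * D / L) with hf
  have hpos := card_mul_sum_position hN f i
  have hsum : (L + 1) * (K ^ 2 / (2 * D)) ≤ ∑ s, f s := by
    rw [Fin.sum_univ_eq_sum_range fun s : ℕ => max 0 (K - s * D / L)]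
    exact le_sum_max_zero_sub L hK hKD
  have h1 : (K ^ 2 / (2 * D)) * (Fintype.card (Fin (L + 1) ≃ α) : ℝ)
      ≤ ∑ σ : Fin (L + 1) ≃ α, f (σ.symm i) := by
    have hc : (0 : ℝ) ≤ Fintype.card (Fin (L + 1) ≃ α) := Nat.cast_nonneg _
    have h2 := mul_le_mul_of_nonneg_left hsum hc
    rw [← hpos] at h2
    push_cast at h2
    have hL1 : (0 : ℝ) < L + 1 := by positivity
    refine le_of_mul_le_mul_left ?_ hL1
    linarith
  refine h1.trans ?_
  rcases Nat.eq_zero_or_pos L with rfl | hL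
  · refine Finset.sum_le_sum fun σ _ => ?_
    have h0 : (Finset.univ.filter fun u => u < σ.symm i) = ∅ := by
      ext u
      have := Fin.eq_zero u
      have := Fin.eq_zero (σ.symm i)
      simp_all
    rw [h0]
    simp [hf]
  -- The truncation is decided by the position of `i` alone, so given the position the demand ahead
  -- of her still enters linearly and may be replaced by its conditional mean.
  set θ : Fin (L + 1) → ℝ := fun s => if 0 ≤ K - (s : ℕ) * D / L then 1 else 0 with hθ
  have hL' : (0 : ℝ) < L := by exact_mod_cast hL
  have hθ0 : ∀ s, 0 ≤ θ s := fun s => by simp only [hθ]; split_ifs <;> norm_num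
  have hfθ : ∀ s, f s = θ s * (K - (s : ℕ) * D / L) := by
    intro s
    simp only [hf, hθ]
    split_ifs with h
    · rw [max_eq_right h, one_mul]
    · rw [max_eq_left (not_le.1 h).le, zero_mul]
  have hb := card_sub_one_mul_sum_before θ i w hN
  have hs0 : 0 ≤ ∑ σ : Fin (L + 1) ≃ α, θ (σ.symm i) * ((σ.symm i : ℕ) : ℝ) :=
    Finset.sum_nonneg fun σ _ => mul_nonneg (hθ0 _) (Nat.cast_nonneg _)
  have h3 := mul_le_mul_of_nonneg_right hD hs0
  rw [← hb] at h3
  push_cast at h3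
  calc ∑ σ : Fin (L + 1) ≃ α, f (σ.symm i)
      = ∑ σ : Fin (L + 1) ≃ α, θ (σ.symm i) * K
        - D / L * ∑ σ : Fin (L + 1) ≃ α, θ (σ.symm i) * ((σ.symm i : ℕ) : ℝ) := by
        rw [Finset.mul_sum, ← Finset.sum_sub_distrib]
        refine Finset.sum_congr rfl fun σ _ => ?_
        rw [hfθ]
        ring
    _ ≤ ∑ σ : Fin (L + 1) ≃ α, θ (σ.symm i) * K
        - ∑ σ : Fin (L + 1) ≃ α, θ (σ.symm i) * ∑ u with u < σ.symm i, w (σ u) := by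
        gcongr
        rw [div_mul_eq_mul_div, le_div_iff₀ hL']
        linarith
    _ = ∑ σ : Fin (L + 1) ≃ α, θ (σ.symm i) * (K - ∑ u with u < σ.symm i, w (σ u)) := by
        rw [← Finset.sum_sub_distrib]
        refine Finset.sum_congr rfl fun σ _ => ?_
        ring
    _ ≤ _ := by
        refine Finset.sum_le_sum fun σ _ => ?_
        simp only [hθ]
        split_ifs
        · rw [one_mul]; exact le_max_right _ _
        · rw [zero_mul]; exact le_max_left _ _

end Order

/-! ### The expected share of one agent in a run of `indivAlloc`. -/

section Alloc

variable {ι : Type} [DecidableEq ι]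

theorem le_expect_foldlM_ofFn {v b : ι → ℝ} (hb : ∀ i, 0 ≤ b i) {p : ℝ} (hp : 0 < p)
    {i : ι} {K M : ℕ} (hK : 0 < K) (hM : M ≤ K) (hr : demand v b p i ≤ K)
    {C c : ℝ} (hc : c ≤ 1) (F : ℝ → ℝ → ℝ≥0∞)
    (hF : ∀ (x : ℕ) (t : ℝ), 0 ≤ t →
      ENNReal.ofReal (C + p * min t M + p * c * (M - min (x : ℝ) M)) ≤ F x t)
    {N : ℕ} (f : Fin N → ι) (hf : Function.Injective f) (t : Fin N) (ht : f t = i) :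
    ENNReal.ofReal (C + p * c * M + p * (1 - c) * (demand v b p i * M / (K : ℝ) ^ 2 *
        max 0 (K - ∑ u with u < t, demand v b p (f u))))
      ≤ expect ((List.ofFn f).foldlM (indivStep v b p) ⟨K, fun _ => 0, fun _ => 0⟩)
        (fun s => F (s.x i) (s.xt i)) := by
  have hlen : (t : ℕ) < (List.ofFn f).length := by simp
  have hsplit : List.ofFn f = (List.ofFn f).take t ++ i :: (List.ofFn f).drop (t + 1) := by
    conv_lhs => rw [← List.take_append_drop (t : ℕ) (List.ofFn f),
      List.drop_eq_getElem_cons hlen]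
    simp [ht]
  have hnd : (List.ofFn f).Nodup := List.nodup_ofFn.2 hf
  rw [hsplit] at hnd
  have hnd' := List.nodup_middle.1 hnd
  rw [List.nodup_cons, List.mem_append, not_or] at hnd'
  have key := le_expect_foldlM_indivStep hb hp hK hM hr hc F hF _ hnd'.1.2 _ hnd'.1.1
    ⟨K, fun _ => 0, fun _ => 0⟩ K le_rfl rfl rfl rfl
  rw [← hsplit] at key
  have hsum : (((List.ofFn f).take t).map (demand v b p)).sum
      = ∑ u with u < t, demand v b p (f u) := by
    rw [List.map_take, List.map_ofFn, List.sum_take_ofFn]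
    rfl
  rw [hsum] at key
  exact key

theorem ofReal_average_le_expect_randomOrder (S : Finset ι) (f : List ι → ℝ≥0∞)
    (g : (Fin S.card ≃ S) → ℝ)
    (hf : ∀ σ, ENNReal.ofReal (g σ) ≤ f (List.ofFn fun t => (σ t : ι))) (c : ℝ)
    (hc : c * Fintype.card (Fin S.card ≃ S) ≤ ∑ σ, g σ) :
    ENNReal.ofReal c ≤ expect (randomOrder S) f := by
  have hinst : ‹DecidableEq ι› = Classical.decEq ι := Subsingleton.elim _ _
  subst hinst
  let : DecidableEq ι := Classical.decEq ι
  have : Nonempty (Fin S.card ≃ S) := ⟨S.equivFin.symm⟩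
  have := ofReal_average_le_expect g (fun σ => f (List.ofFn fun t => (σ t : ι))) hf c hc
  rw [← expect_map _ (fun σ : Fin S.card ≃ S => List.ofFn fun t => (σ t : ι)) f] at this
  exact this

/-- For a fixed order the gain is `demand * M / K ^ 2` times the supply left before `i`. The mean of
the latter is at least `K ^ 2 / (2 * D)`, and `K ^ 2` cancels. -/
theorem le_expect_indivAlloc {v b : ι → ℝ} (hb : ∀ i, 0 ≤ b i) {p : ℝ} (hp : 0 < p)
    {i : ι} {K M : ℕ} (hK : 0 < K) (hM : M ≤ K) (hr : demand v b p i ≤ K)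
    {C c : ℝ} (hc : c ≤ 1) (F : ℝ → ℝ → ℝ≥0∞)
    (hF : ∀ (x : ℕ) (t : ℝ), 0 ≤ t →
      ENNReal.ofReal (C + p * min t M + p * c * (M - min (x : ℝ) M)) ≤ F x t)
    {S : Finset ι} (hi : i ∈ S) {D : ℝ} (hKD : K ≤ D)
    (hD : ∑ l ∈ S.erase i, demand v b p l ≤ D) :
    ENNReal.ofReal (C + p * c * M + p * (1 - c) * (M * (demand v b p i / (2 * D))))
      ≤ expect (indivAlloc v b S p K) (fun y => F (y.1 i) (y.2 i)) := by
  unfold indivAlloc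
  rw [expect_bind]
  simp_rw [expect_bind, expect_pure]
  set g : (Fin S.card ≃ S) → ℝ := fun σ => C + p * c * M +
      p * (1 - c) * (demand v b p i * M / (K : ℝ) ^ 2 *
        max 0 (K - ∑ u with u < σ.symm ⟨i, hi⟩, demand v b p (σ u))) with hg
  refine ofReal_average_le_expect_randomOrder S _ g (fun σ => ?_) _ ?_
  · exact le_expect_foldlM_ofFn hb hp hK hM hr hc F hF _
      (Subtype.val_injective.comp σ.injective) (σ.symm ⟨i, hi⟩) (by simp)
  · have hK' : (0 : ℝ) < K := by exact_mod_cast hK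
    have hD0 : 0 < D := hK'.trans_le hKD
    have hsum : ∑ l ∈ (Finset.univ : Finset S).erase ⟨i, hi⟩, demand v b p l
        = ∑ l ∈ S.erase i, demand v b p l := by
      rw [Finset.sum_erase_eq_sub (Finset.mem_univ _), Finset.sum_erase_eq_sub hi,
        Finset.sum_coe_sort S (demand v b p)]
    have havg := le_sum_max_zero_sub_before (N := S.card) (by simp) (⟨i, hi⟩ : S)
      (w := fun l : S => demand v b p l) hK' hKD (hsum.le.trans hD)
    have hcoef : 0 ≤ p * (1 - c) * (demand v b p i * M / (K : ℝ) ^ 2) := by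
      have h1 := demand_nonneg (v := v) hb hp i
      have h2 : 0 ≤ 1 - c := by linarith
      positivity
    have h3 := mul_le_mul_of_nonneg_left havg hcoef
    simp only [hg]
    rw [Finset.sum_add_distrib, Finset.sum_const, Finset.card_univ, nsmul_eq_mul]
    simp_rw [← mul_assoc, ← Finset.mul_sum]
    have h4 : ∀ q : ℝ, (C + p * c * M + p * (1 - c) * M * (demand v b p i / (2 * D))) * q
        = q * (C + p * c * M) + p * (1 - c) * (demand v b p i * M / (K : ℝ) ^ 2) *
          (K ^ 2 / (2 * D) * q) := by
      intro q
      field_simp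
    rw [h4]
    convert add_le_add_right h3 _ using 2

end Alloc

/-! ### The revenue collection phase -/

namespace Draw

variable {n : ℕ}

/-- The part of the sampling set on side `σ`, without the pivot agent. -/
def sample (D : Draw n) (σ : Bool) : Finset (Fin (n + 1)) :=
  bif σ then D.A₁ else D.A₂.erase D.pivot

theorem mem_sample (D : Draw n) (σ : Bool) (i : Fin (n + 1)) :
    i ∈ D.sample σ ↔ D.order.symm i < D.pivotSlot ∧ D.side (D.order.symm i) = σ := by
  have hor : ∀ q : Fin (n + 1) → Prop, (∃ s, q s ∧ D.order s = i) ↔ q (D.order.symm i) := by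
    intro q
    constructor
    · rintro ⟨s, hs, rfl⟩
      simpa using hs
    · exact fun h => ⟨_, h, by simp⟩
  cases σ
  · have : D.order.symm i < D.pivotSlot → i ≠ D.pivot := by
      rintro h rfl
      simp [pivot] at h
    simp only [sample, A₂, cond_false, Finset.mem_erase, Finset.mem_insert, Finset.mem_image,
      Finset.mem_filter, Finset.mem_univ, true_and, hor]
    tauto
  · simp only [sample, A₁, cond_true, Finset.mem_image, Finset.mem_filter, Finset.mem_univ,
      true_and, hor]

theorem notMem_sample_of_later (D : Draw n) (σ : Bool) {s : Fin (n + 1)}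
    (hs : D.pivotSlot < s) : D.order s ∉ D.sample σ := by
  rw [mem_sample]
  simp [hs.le]

end Draw

namespace CollectState

variable {ι : Type}

/-- Items left on side `σ`. -/
def supply (c : CollectState ι) (σ : Bool) : ℝ := bif σ then c.m₁ else c.m₂

/-- Agent `i` on side `σ` with allocation `x` and charged allocation `t` is served at price
`p`. -/
def serve [DecidableEq ι] (c : CollectState ι) (σ : Bool) (i : ι) (p x t : ℝ) :
    CollectState ι where
  m₁ := bif σ then c.m₁ - min x c.m₁ else c.m₁
  m₂ := bif σ then c.m₂ else c.m₂ - min x c.m₂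
  out :=
    { alloc := Function.update c.out.alloc i (min x (c.supply σ))
      pay := Function.update c.out.pay i (min t (c.supply σ) * p) }

/-- Supplies are natural numbers and payments are nonnegative. -/
structure Valid (c : CollectState ι) : Prop where
  supply : ∀ σ, ∃ k : ℕ, c.supply σ = k
  pay : ∀ i, 0 ≤ c.out.pay i

theorem serve_supply_self [DecidableEq ι] (c : CollectState ι) (σ : Bool) (i : ι)
    (p x t : ℝ) : (c.serve σ i p x t).supply σ = c.supply σ - min x (c.supply σ) := by
  cases σ <;> rfl

theorem serve_supply_of_ne [DecidableEq ι] (c : CollectState ι) {σ τ : Bool} (h : σ ≠ τ)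
    (i : ι) (p x t : ℝ) : (c.serve σ i p x t).supply τ = c.supply τ := by
  cases σ <;> cases τ <;> first | rfl | exact absurd rfl h

theorem Valid.serve [DecidableEq ι] {c : CollectState ι} (hc : c.Valid) (σ : Bool) (i : ι)
    {p t : ℝ} (hp : 0 ≤ p) (ht : 0 ≤ t) (x : ℕ) : (c.serve σ i p x t).Valid := by
  refine ⟨fun τ => ?_, fun l => ?_⟩
  · obtain ⟨k, hk⟩ := hc.supply τ
    by_cases h : σ = τ
    · subst h
      refine ⟨k - min x k, ?_⟩
      rw [serve_supply_self, hk, Nat.cast_sub (min_le_right _ _), Nat.cast_min]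
    · exact ⟨k, by rw [serve_supply_of_ne c h, hk]⟩
  · obtain ⟨k, hk⟩ := hc.supply σ
    by_cases h : l = i
    · subst h
      simp only [CollectState.serve, Function.update_self, hk]
      positivity
    · simpa [CollectState.serve, h] using hc.pay l

end CollectState

section Collect

variable {n : ℕ}

/-- Removing the pivot makes the two branches symmetric in the side. A later agent is not the pivot,
so inserting her and erasing the pivot commute. -/
theorem collectStep_eq (m : ℝ) (P : Finset (Fin (n + 1)) → ℝ)
    (Alloc : Finset (Fin (n + 1)) → ℝ → ℝ → PMF ((Fin (n + 1) → ℝ) × (Fin (n + 1) → ℝ)))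
    (D : Draw n) (c : CollectState (Fin (n + 1))) {s : Fin (n + 1)} (hs : D.pivotSlot < s) :
    collectStep m P Alloc D c s =
      Alloc (insert (D.order s) (D.sample (D.side s))) (P (D.sample (!D.side s))) (m / 4) >>=
        fun y => pure (c.serve (D.side s) (D.order s) (P (D.sample (!D.side s)))
          (y.1 (D.order s)) (y.2 (D.order s))) := by
  have hne : D.order s ≠ D.pivot := by
    intro h
    exact hs.ne' (D.order.injective h)
  unfold collectStep
  cases h : D.side s
  · simp only [Bool.false_eq_true, if_false, Draw.sample, cond_false, Bool.not_false, cond_true]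
    rw [Finset.erase_insert_of_ne hne]
    rfl
  · simp only [if_true, Draw.sample, cond_true, Bool.not_true, cond_false]
    rfl

/-- Lower bound for the mean fraction of the supply on side `τ` that agent `i` gets when the
total competing demand is at most `Q`. -/
def shareBound (v b : Fin (n + 1) → ℝ) (p Q : ℝ) (i : Fin (n + 1)) : ℝ :=
  demand v b p i / (2 * Q)

/-- Upper bound for the mean fraction of the supply on side `τ` left after the slots `L`. -/
def leftBound (v b : Fin (n + 1) → ℝ) (p Q : ℝ) (D : Draw n) (τ : Bool)
    (L : List (Fin (n + 1))) : ℝ :=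
  (L.map fun s => if D.side s = τ then 1 - shareBound v b p Q (D.order s) else 1).prod

theorem sum_pay_serve (c : CollectState (Fin (n + 1))) (σ : Bool) (D : Draw n) (s : Fin (n + 1))
    (L : List (Fin (n + 1))) (hs : s ∉ L) (p x t : ℝ) :
    ∑ i with i ∉ L.map D.order, (c.serve σ (D.order s) p x t).out.pay i
      = ∑ i with i ∉ (s :: L).map D.order, c.out.pay i + min t (c.supply σ) * p := by
  have hmem : D.order s ∉ L.map D.order := by
    rw [List.mem_map]
    rintro ⟨s', hs', h⟩
    exact hs (D.order.injective h ▸ hs')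
  have hset : (Finset.univ.filter fun i => i ∉ L.map D.order)
      = insert (D.order s) (Finset.univ.filter fun i => i ∉ (s :: L).map D.order) := by
    ext i
    simp only [Finset.mem_filter, Finset.mem_univ, true_and, Finset.mem_insert, List.map_cons,
      List.mem_cons, not_or]
    constructor
    · intro h
      by_cases hi : i = D.order s
      · exact Or.inl hi
      · exact Or.inr ⟨hi, h⟩
    · rintro (rfl | h)
      · exact hmem
      · exact h.2
  rw [hset, Finset.sum_insert (by simp), add_comm]
  congr 1
  · refine Finset.sum_congr rfl fun i hi => ?_
    have : i ≠ D.order s := by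
      rintro rfl
      simp at hi
    simp [CollectState.serve, this]
  · simp [CollectState.serve]

/-- Induction over the agents still to come. Payments of agents in `L` are left out of the sum
because their entries are overwritten when they are served. -/
theorem le_expect_foldlM_collectStep {v b : Fin (n + 1) → ℝ} (hb : ∀ i, 0 ≤ b i)
    {P : Finset (Fin (n + 1)) → ℝ} (hP : ∀ S, 0 < P S) {m : ℝ} {K : ℕ} (hK : 0 < K)
    (hmK : m / 4 = K) (D : Draw n) (τ : Bool) {p Q : ℝ} (hp : p = P (D.sample !τ))
    (hKQ : K ≤ Q) (hQ : ∑ l ∈ D.sample τ, demand v b p l ≤ Q)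
    (L : List (Fin (n + 1))) : L.Nodup → (∀ s ∈ L, D.pivotSlot < s) →
    (∀ s ∈ L, D.side s = τ → demand v b p (D.order s) ≤ K) →
    ∀ c : CollectState (Fin (n + 1)), c.Valid → c.supply τ ≤ K →
    ENNReal.ofReal (∑ i with i ∉ L.map D.order, c.out.pay i
        + p * c.supply τ * (1 - leftBound v b p Q D τ L))
      ≤ expect (L.foldlM (collectStep m P (indivAlloc v b) D) c)
        fun c' => ENNReal.ofReal (∑ i, c'.out.pay i) := by
  have hp0 : 0 < p := hp ▸ hP _
  have hK' : (0 : ℝ) < K := by exact_mod_cast hK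
  induction L with
  | nil =>
    intro _ _ _ c _ _
    rw [List.foldlM_nil, expect_pure]
    simp [leftBound]
  | cons s L ih =>
    intro hnd hlater hdem c hc hcK
    rw [List.nodup_cons] at hnd
    have ih' := ih hnd.2 (fun s hs => hlater s (List.mem_cons_of_mem _ hs))
      (fun s hs => hdem s (List.mem_cons_of_mem _ hs))
    have hs := hlater s List.mem_cons_self
    rw [List.foldlM_cons, expect_bind, collectStep_eq m P _ D c hs, expect_bind]
    simp_rw [expect_pure]
    set i := D.order s with hi
    have hleft0 : 0 ≤ leftBound v b p Q D τ L := by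
      refine List.prod_nonneg fun x hx => ?_
      obtain ⟨s', hs', rfl⟩ := List.mem_map.1 hx
      split_ifs with h
      · have h1 := hdem s' (List.mem_cons_of_mem _ hs') h
        have : shareBound v b p Q (D.order s') ≤ 1 := by
          unfold shareBound
          rw [div_le_one (by linarith)]
          linarith
        linarith
      · exact zero_le_one
    have hcons : leftBound v b p Q D τ (s :: L)
        = (if D.side s = τ then 1 - shareBound v b p Q i else 1) * leftBound v b p Q D τ L := by
      simp [leftBound, hi]
    set W := ∑ i with i ∉ (s :: L).map D.order, c.out.pay i with hW
    by_cases hτ : D.side s = τ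
    · obtain ⟨M, hM⟩ := hc.supply τ
      rw [hτ, ← hp, hmK]
      have hMK : M ≤ K := by
        rw [hM] at hcK
        exact_mod_cast hcK
      -- With `ℓ` the bound for the unsold fraction after the remaining slots and `s` the share of
      -- the current agent, `c = 1 - ℓ` gives `c + (1 - c) * s = 1 - (1 - s) * ℓ`, the recursion of
      -- the product.
      have key := le_expect_indivAlloc (S := insert i (D.sample τ)) (i := i) hb hp0 hK hMK
        (hdem s List.mem_cons_self hτ) (C := W) (c := 1 - leftBound v b p Q D τ L)
        (by linarith)
        (fun x t => expect (L.foldlM (collectStep m P (indivAlloc v b) D) (c.serve τ i p x t))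
          fun c' => ENNReal.ofReal (∑ i, c'.out.pay i))
        (fun x t ht => by
          refine le_trans (le_of_eq ?_) (ih' (c.serve τ i p x t) (hc.serve τ i hp0.le ht x) ?_)
          · rw [sum_pay_serve c τ D s L hnd.1, c.serve_supply_self, hM, ← hW]
            ring_nf
          · rw [c.serve_supply_self, hM]
            have : 0 ≤ min (x : ℝ) M := by positivity
            rw [hM] at hcK
            linarith)
        (Finset.mem_insert_self _ _) hKQ
        (by rwa [Finset.erase_insert (D.notMem_sample_of_later τ hs)])
      refine le_trans (le_of_eq ?_) key
      rw [hcons, if_pos hτ, hM]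
      unfold shareBound
      ring_nf
    -- An agent of the other side leaves the supply of side `τ` unchanged, and her payment is
    -- nonnegative.
    · refine le_expect _ fun y hy => ?_
      obtain ⟨hy1, hy2⟩ := indivAlloc_support hb (hP _) _ K y (hmK ▸ hy)
      obtain ⟨x, hx⟩ := hy1 i
      rw [hx]
      have hp1 := hP (D.sample !D.side s)
      refine le_trans (ENNReal.ofReal_le_ofReal ?_)
        (ih' _ (hc.serve (D.side s) i hp1.le (hy2 i) x) ?_)
      · rw [sum_pay_serve c _ D s L hnd.1, c.serve_supply_of_ne hτ, hcons, if_neg hτ, one_mul,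
          ← hW]
        obtain ⟨k, hk⟩ := hc.supply (D.side s)
        have h2 := hy2 i
        have : 0 ≤ min (y.2 i) (c.supply (D.side s)) * P (D.sample !D.side s) := by
          rw [hk]
          positivity
        linarith
      · rw [c.serve_supply_of_ne hτ]
        exact hcK

theorem samplingPhase_support {v b : Fin (n + 1) → ℝ} (hb : ∀ i, 0 ≤ b i)
    {P : Finset (Fin (n + 1)) → ℝ} (hP : ∀ S, 0 < P S) {m : ℝ} {K : ℕ} (hmK : m / 4 = K)
    (d a : Fin (n + 1) → ℝ) (D : Draw n) :
    ∀ o ∈ (samplingPhase d a m P (indivAlloc v b) D).support, ∀ i, 0 ≤ o.pay i := by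
  intro o ho i
  unfold samplingPhase at ho
  rw [hmK] at ho
  obtain ⟨y, hy, ho⟩ := (PMF.mem_support_bind_iff _ _ _).1 ho
  obtain ⟨z, hz, ho⟩ := (PMF.mem_support_bind_iff _ _ _).1 ho
  have ho' : o = _ := (PMF.mem_support_pure_iff _ _).1 ho
  subst ho'
  have h1 := (indivAlloc_support hb (hP _) _ K y hy).2 i
  have h2 := (indivAlloc_support hb (hP _) _ K z hz).2 i
  simp only
  split_ifs
  · exact mul_nonneg h1 (hP _).le
  · exact mul_nonneg h2 (hP _).le
  · exact le_rfl

theorem laterSlots_nodup (D : Draw n) : D.laterSlots.Nodup :=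
  (List.nodup_finRange _).filter _

theorem mem_laterSlots (D : Draw n) (s : Fin (n + 1)) : s ∈ D.laterSlots ↔ D.pivotSlot < s := by
  simp [Draw.laterSlots]

theorem le_expectedRevenue_leftBound {v b : Fin (n + 1) → ℝ} (hb : ∀ i, 0 ≤ b i)
    {P : Finset (Fin (n + 1)) → ℝ} (hP : ∀ S, 0 < P S) {m : ℝ} {K : ℕ} (hK : 0 < K)
    (hmK : m / 4 = K) (a d : Fin (n + 1) → ℝ) (D : Draw n) (τ : Bool) {p Q : ℝ}
    (hp : p = P (D.sample !τ))
    (hKQ : K ≤ Q) (hQ : ∑ l ∈ D.sample τ, demand v b p l ≤ Q)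
    (hdem : ∀ s, D.pivotSlot < s → D.side s = τ → demand v b p (D.order s) ≤ K) :
    ENNReal.ofReal (p * K * (1 - leftBound v b p Q D τ D.laterSlots))
      ≤ expectedRevenue (revIndiv a d v b m P D) := by
  change _ ≤ expect _ fun o : Outcome (Fin (n + 1)) => ENNReal.ofReal (∑ i, o.pay i)
  unfold revIndiv rsOnline
  rw [expect_bind]
  refine le_expect _ fun o ho => ?_
  have hpay := samplingPhase_support hb hP hmK d a D o ho
  rw [expect_bind]
  simp_rw [expect_pure]
  have hsup : ∀ σ, (⟨m / 4, m / 4, o⟩ : CollectState (Fin (n + 1))).supply σ = K := by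
    intro σ
    cases σ <;> exact hmK
  have key := le_expect_foldlM_collectStep hb hP hK hmK D τ hp hKQ hQ D.laterSlots
    (laterSlots_nodup D) (fun s hs => (mem_laterSlots D s).1 hs)
    (fun s hs => hdem s ((mem_laterSlots D s).1 hs)) ⟨m / 4, m / 4, o⟩
    ⟨fun σ => ⟨K, hsup σ⟩, hpay⟩ (hsup τ).le
  refine le_trans (ENNReal.ofReal_le_ofReal ?_) key
  rw [hsup]
  have : 0 ≤ ∑ i with i ∉ D.laterSlots.map D.order, o.pay i :=
    Finset.sum_nonneg fun i _ => hpay i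
  linarith

/-- The agents on side `σ` that arrive after the pivot agent. -/
def Draw.later (D : Draw n) (σ : Bool) : Finset (Fin (n + 1)) :=
  Finset.univ.filter fun i => D.pivotSlot < D.order.symm i ∧ D.side (D.order.symm i) = σ

theorem leftBound_le_exp (v b : Fin (n + 1) → ℝ) (p Q : ℝ) (D : Draw n) (τ : Bool)
    (h1 : ∀ i ∈ D.later τ, shareBound v b p Q i ≤ 1) :
    leftBound v b p Q D τ D.laterSlots
      ≤ Real.exp (-((∑ i ∈ D.later τ, demand v b p i) / (2 * Q))) := by
  have hfin : leftBound v b p Q D τ D.laterSlots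
      = ∏ i ∈ D.later τ, (1 - shareBound v b p Q i) := by
    unfold leftBound
    rw [← List.prod_toFinset _ (laterSlots_nodup D), ← Finset.prod_filter]
    refine Finset.prod_nbij' D.order D.order.symm ?_ ?_ ?_ ?_ ?_
    · intro s hs
      simp only [Finset.mem_filter, List.mem_toFinset, mem_laterSlots] at hs
      simp [Draw.later, hs]
    · intro i hi
      simp only [Draw.later, Finset.mem_filter] at hi
      simp [mem_laterSlots, hi]
    · simp
    · simp
    · simp
  rw [hfin, Finset.sum_div, ← Finset.sum_neg_distrib, Real.exp_sum]
  refine Finset.prod_le_prod (fun i hi => by linarith [h1 i hi]) fun i _ => ?_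
  have := Real.add_one_le_exp (-(demand v b p i / (2 * Q)))
  unfold shareBound
  linarith

/-- The mechanism earns from side `τ` at least a constant fraction of the smallest of the
supply, the demand of the later agents and their share in the total demand. -/
theorem le_expectedRevenue {v b : Fin (n + 1) → ℝ} (hb : ∀ i, 0 ≤ b i)
    {P : Finset (Fin (n + 1)) → ℝ} (hP : ∀ S, 0 < P S) {m : ℝ} {K : ℕ} (hK : 0 < K)
    (hmK : m / 4 = K) (a d : Fin (n + 1) → ℝ) (D : Draw n) (τ : Bool) {p Q : ℝ}
    (hp : p = P (D.sample !τ))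
    (hKQ : p * K ≤ Q) (hQ : ∑ l ∈ D.sample τ with p ≤ v l, b l ≤ Q)
    (hdem : ∀ i ∈ D.later τ, b i ≤ p * K) :
    ENNReal.ofReal (p * K *
        (1 - Real.exp (-((∑ i ∈ D.later τ with p ≤ v i, b i) / (2 * Q)))))
      ≤ expectedRevenue (revIndiv a d v b m P D) := by
  have hp0 : 0 < p := hp ▸ hP _
  have hK' : (0 : ℝ) < K := by exact_mod_cast hK
  have hsum : ∀ S : Finset (Fin (n + 1)),
      ∑ i ∈ S, demand v b p i = (∑ i ∈ S with p ≤ v i, b i) / p := by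
    intro S
    unfold demand
    rw [Finset.sum_div, Finset.sum_filter]
  have hdem' : ∀ i ∈ D.later τ, demand v b p i ≤ K := by
    intro i hi
    unfold demand
    split_ifs
    · rw [div_le_iff₀ hp0, mul_comm]
      exact hdem i hi
    · exact hK'.le
  have hKQ' : K ≤ Q / p := by rwa [le_div_iff₀ hp0, mul_comm]
  refine le_trans (ENNReal.ofReal_le_ofReal ?_)
    (le_expectedRevenue_leftBound (Q := Q / p) hb hP hK hmK a d D τ hp hKQ'
      (by rw [hsum]; gcongr) fun s hs hτ => hdem' _ (by simp [Draw.later, hs, hτ]))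
  have h := leftBound_le_exp v b p (Q / p) D τ fun i hi => by
    unfold shareBound
    rw [div_le_one (by linarith)]
    linarith [hdem' i hi]
  rw [hsum, mul_div_assoc', div_div_div_cancel_right₀ hp0.ne'] at h
  gcongr


end Collect

/-! ### Concentration for uniformly random colourings -/

section Concentration

/-- The exponential Markov inequality in counting form. Probabilities are handled as cardinalities
throughout. -/
theorem card_filter_mul_exp_le {Ω : Type} [Fintype Ω] (X : Ω → ℝ) (t : ℝ) :
    ((Finset.univ.filter fun ω => t ≤ X ω).card : ℝ) * Real.exp t
      ≤ ∑ ω, Real.exp (X ω) := by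
  calc ((Finset.univ.filter fun ω => t ≤ X ω).card : ℝ) * Real.exp t
      = ∑ ω with t ≤ X ω, Real.exp t := by rw [Finset.sum_const, nsmul_eq_mul]
    _ ≤ ∑ ω with t ≤ X ω, Real.exp (X ω) :=
        Finset.sum_le_sum fun ω hω => Real.exp_le_exp.2 (Finset.mem_filter.1 hω).2
    _ ≤ _ := Finset.sum_le_sum_of_subset_of_nonneg (Finset.filter_subset _ _)
        fun _ _ _ => (Real.exp_pos _).le

variable {ι : Type} [Fintype ι] [DecidableEq ι]

theorem sum_prod_apply_bool (h : ι → Bool → ℝ) :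
    ∑ f : ι → Bool, ∏ i, h i (f i) = ∏ i, (h i true + h i false) := by
  have := Finset.prod_univ_sum (fun _ : ι => (Finset.univ : Finset Bool)) h
  rw [Fintype.piFinset_univ] at this
  rw [← this]
  simp

/-- The sign `±1` of a coin. -/
def coinSign (x : Bool) : ℝ := bif x then 1 else -1

/-- Hoeffding's inequality for a weighted sum of fair signs. -/
theorem card_coinSign_sum_ge_le (w : ι → ℝ) {V t : ℝ} (hV : 0 < V) (ht : 0 ≤ t)
    (hw : ∑ i, w i ^ 2 ≤ V) :
    ((Finset.univ.filter fun f : ι → Bool => t ≤ ∑ i, coinSign (f i) * w i).card : ℝ)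
      ≤ Fintype.card (ι → Bool) * Real.exp (-(t ^ 2 / (2 * V))) := by
  -- The minimizer of the Chernoff exponent `L ^ 2 * V / 2 - L * t`.
  set L := t / V with hL
  have hL0 : 0 ≤ L := by positivity
  have h1 := card_filter_mul_exp_le
    (fun f : ι → Bool => ∑ i, L * (coinSign (f i) * w i)) (L * t)
  have hmono : (Finset.univ.filter fun f : ι → Bool => t ≤ ∑ i, coinSign (f i) * w i)
      ⊆ Finset.univ.filter fun f : ι → Bool =>
        L * t ≤ ∑ i, L * (coinSign (f i) * w i) := by
    intro f hf
    simp only [Finset.mem_filter, Finset.mem_univ, true_and] at hf ⊢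
    rw [← Finset.mul_sum]
    gcongr
  have hcard := Nat.cast_le (α := ℝ).2 (Finset.card_le_card hmono)
  have h2 : ∑ f : ι → Bool, Real.exp (∑ i, L * (coinSign (f i) * w i))
      ≤ Fintype.card (ι → Bool) * Real.exp (L ^ 2 * V / 2) := by
    simp_rw [Real.exp_sum]
    rw [sum_prod_apply_bool fun i x => Real.exp (L * (coinSign x * w i))]
    calc ∏ i, (Real.exp (L * (coinSign true * w i)) + Real.exp (L * (coinSign false * w i)))
        ≤ ∏ i, (2 * Real.exp (L ^ 2 * w i ^ 2 / 2)) := by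
          refine Finset.prod_le_prod (fun i _ => by positivity) fun i _ => ?_
          have := Real.cosh_le_exp_half_sq (L * w i)
          rw [Real.cosh_eq, mul_pow] at this
          simp only [coinSign, cond_true, cond_false, one_mul, neg_mul, mul_neg]
          linarith
      _ = Fintype.card (ι → Bool) * Real.exp (∑ i, L ^ 2 * w i ^ 2 / 2) := by
          rw [Finset.prod_mul_distrib, Finset.prod_const, Real.exp_sum]
          simp
      _ ≤ _ := by
          rw [← Finset.sum_div, ← Finset.mul_sum]
          gcongr
  have h3 : Real.exp (-(t ^ 2 / (2 * V))) = Real.exp (L ^ 2 * V / 2) / Real.exp (L * t) := by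
    rw [← Real.exp_sub]
    congr 1
    rw [hL]
    field_simp
    ring
  rw [h3, ← mul_div_assoc, le_div_iff₀ (Real.exp_pos _)]
  refine le_trans ?_ (h1.trans h2)
  gcongr

/-- Since `exp x ≥ 1 + x + x ^ 2 / 2` and the two quadratics multiply to `1 + x ^ 4 / 4`. This
one-sided bound is what makes second moments suffice for the lower tail. -/
theorem exp_neg_le_quadratic {x : ℝ} (hx : 0 ≤ x) : Real.exp (-x) ≤ 1 - x + x ^ 2 / 2 := by
  have h := Real.quadratic_le_exp_of_nonneg hx
  rw [Real.exp_neg, inv_le_iff_one_le_mul₀ (Real.exp_pos x)]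
  have h2 : 0 ≤ 1 - x + x ^ 2 / 2 := by nlinarith [sq_nonneg (x - 1)]
  nlinarith [mul_le_mul_of_nonneg_left h h2, sq_nonneg (x ^ 2)]

/-- Lower tail bound for the weight of a random subset of density `1/4`. -/
theorem card_quarter_sum_le_le {c : ι → ℝ} (hc : ∀ i, 0 ≤ c i) {V t : ℝ} (hV : 0 < V)
    (ht : 0 ≤ t) (hcV : ∑ i, c i ^ 2 ≤ V) (σ : Bool) :
    ((Finset.univ.filter fun ω : (ι → Bool) × (ι → Bool) =>
        ∑ i with ω.1 i = true ∧ ω.2 i = σ, c i ≤ (∑ i, c i) / 4 - t).card : ℝ)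
      ≤ Fintype.card ((ι → Bool) × (ι → Bool)) * Real.exp (-(2 * t ^ 2 / V)) := by
  -- The minimizer of `L ^ 2 * V / 8 - L * t`, with minimum `-(2 * t ^ 2 / V)`.
  set L := 4 * t / V with hL
  have hL0 : 0 ≤ L := by positivity
  set S := ∑ i, c i with hS
  set h : ι → Bool → Bool → ℝ := fun i x y =>
    Real.exp (-(L * if x = true ∧ y = σ then c i else 0)) with hh
  have h1 := card_filter_mul_exp_le
    (fun ω : (ι → Bool) × (ι → Bool) =>
      ∑ i, -(L * if ω.1 i = true ∧ ω.2 i = σ then c i else 0)) (-(L * (S / 4 - t)))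
  have hmono : (Finset.univ.filter fun ω : (ι → Bool) × (ι → Bool) =>
        ∑ i with ω.1 i = true ∧ ω.2 i = σ, c i ≤ S / 4 - t)
      ⊆ Finset.univ.filter fun ω : (ι → Bool) × (ι → Bool) => -(L * (S / 4 - t)) ≤
        ∑ i, -(L * if ω.1 i = true ∧ ω.2 i = σ then c i else 0) := by
    intro f hf
    simp only [Finset.mem_filter, Finset.mem_univ, true_and] at hf ⊢
    rw [Finset.sum_neg_distrib, ← Finset.mul_sum, ← Finset.sum_filter]
    have := mul_le_mul_of_nonneg_left hf hL0
    linarith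
  have hcard := Nat.cast_le (α := ℝ).2 (Finset.card_le_card hmono)
  have h2 : ∑ ω : (ι → Bool) × (ι → Bool),
      Real.exp (∑ i, -(L * if ω.1 i = true ∧ ω.2 i = σ then c i else 0))
      ≤ Fintype.card ((ι → Bool) × (ι → Bool)) * Real.exp (-(L * S / 4) + L ^ 2 * V / 8) := by
    simp_rw [Real.exp_sum]
    have e : ∑ ω : (ι → Bool) × (ι → Bool), ∏ i, h i (ω.1 i) (ω.2 i)
        = ∏ i, ((h i true true + h i true false) + (h i false true + h i false false)) := by
      rw [Fintype.sum_prod_type]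
      have : ∀ u : ι → Bool, ∑ s : ι → Bool, ∏ i, h i (u i) (s i)
          = ∏ i, (h i (u i) true + h i (u i) false) :=
        fun u => sum_prod_apply_bool fun i x => h i (u i) x
      simp_rw [this]
      exact sum_prod_apply_bool fun i x => h i x true + h i x false
    rw [e]
    calc ∏ i, ((h i true true + h i true false) + (h i false true + h i false false))
        ≤ ∏ i, (4 * Real.exp (-(L * c i / 4) + L ^ 2 * c i ^ 2 / 8)) := by
          refine Finset.prod_le_prod (fun i _ => by positivity) fun i _ => ?_
          -- Three of the four coin pairs contribute 1, and with `y = L * c i` one has `3 + exp (-y)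
          -- ≤ 4 * (1 - y / 4 + y ^ 2 / 8)`.
          have q1 := exp_neg_le_quadratic (mul_nonneg hL0 (hc i))
          have q2 := Real.add_one_le_exp (-(L * c i / 4) + L ^ 2 * c i ^ 2 / 8)
          have q3 : (h i true true + h i true false) + (h i false true + h i false false)
              = 3 + Real.exp (-(L * c i)) := by
            cases σ <;> simp [hh] <;> ring
          rw [q3]
          nlinarith
      _ = Fintype.card ((ι → Bool) × (ι → Bool)) *
          Real.exp (∑ i, (-(L * c i / 4) + L ^ 2 * c i ^ 2 / 8)) := by
          rw [Finset.prod_mul_distrib, Finset.prod_const, Real.exp_sum]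
          congr 1
          simp only [Finset.card_univ, Fintype.card_prod, Fintype.card_pi, Fintype.card_bool,
            Finset.prod_const]
          push_cast
          rw [← mul_pow]
          norm_num
      _ ≤ _ := by
          rw [Finset.sum_add_distrib, Finset.sum_neg_distrib, ← Finset.sum_div,
            ← Finset.sum_div, ← Finset.mul_sum, ← Finset.mul_sum]
          gcongr
  have h3 : Real.exp (-(2 * t ^ 2 / V))
      = Real.exp (-(L * S / 4) + L ^ 2 * V / 8) / Real.exp (-(L * (S / 4 - t))) := by
    rw [← Real.exp_sub]
    congr 1
    rw [hL]
    field_simp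
    ring
  rw [h3, ← mul_div_assoc, le_div_iff₀ (Real.exp_pos _)]
  refine le_trans ?_ (h1.trans h2)
  gcongr

/-- The agents other than `j` with first coin `x` and second coin `σ`. -/
def colourClass (j : ι) (ω : (ι → Bool) × (ι → Bool)) (x σ : Bool) : Finset ι :=
  Finset.univ.filter fun i => i ≠ j ∧ ω.1 i = x ∧ ω.2 i = σ

theorem sum_colourClass (j : ι) (ω : (ι → Bool) × (ι → Bool)) (σ : Bool) (v b : ι → ℝ)
    (p α β : ℝ) :
    α * ∑ i ∈ colourClass j ω true σ with p ≤ v i, b i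
        + β * ∑ i ∈ colourClass j ω false σ with p ≤ v i, b i
      = ∑ i with (i ≠ j ∧ ω.2 i = σ) ∧ p ≤ v i, (bif ω.1 i then α else β) * b i := by
  unfold colourClass
  rw [Finset.filter_filter, Finset.filter_filter, Finset.mul_sum, Finset.mul_sum,
    Finset.sum_filter, Finset.sum_filter, Finset.sum_filter, ← Finset.sum_add_distrib]
  refine Finset.sum_congr rfl fun i _ => ?_
  cases ω.1 i <;> simp

/-- For a price that depends only on the sampled agents of the other side, the demand of the
sampled agents is not much larger than that of the later agents of the same side. -/
theorem card_imbalance_le (j : ι) (v b : ι → ℝ) (hb : ∀ i, 0 ≤ b i) (π : Finset ι → ℝ)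
    (σ : Bool) {β κ : ℝ} (hβ : 0 < β) (hbβ : ∀ i, i ≠ j → b i ≤ β) (hκ : 0 ≤ κ) :
    ((Finset.univ.filter fun ω : (ι → Bool) × (ι → Bool) =>
        κ * √(∑ i ∈ colourClass j ω true σ with π (colourClass j ω true !σ) ≤ v i, b i
            + ∑ i ∈ colourClass j ω false σ with π (colourClass j ω true !σ) ≤ v i, b i)
          < ∑ i ∈ colourClass j ω true σ with π (colourClass j ω true !σ) ≤ v i, b i
            - ∑ i ∈ colourClass j ω false σ with π (colourClass j ω true !σ) ≤ v i, b i
        ).card : ℝ)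
      ≤ Fintype.card ((ι → Bool) × (ι → Bool)) * Real.exp (-(κ ^ 2 / (2 * β))) := by
  classical
  have hsum : ∀ (ω : (ι → Bool) × (ι → Bool)) (p : ℝ),
      ∑ i ∈ colourClass j ω true σ with p ≤ v i, b i
        + ∑ i ∈ colourClass j ω false σ with p ≤ v i, b i
      = ∑ i with (i ≠ j ∧ ω.2 i = σ) ∧ p ≤ v i, b i := by
    intro ω p
    have := sum_colourClass j ω σ v b p 1 1
    simpa using this
  have hdiff : ∀ (ω : (ι → Bool) × (ι → Bool)) (p : ℝ),
      ∑ i ∈ colourClass j ω true σ with p ≤ v i, b i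
        - ∑ i ∈ colourClass j ω false σ with p ≤ v i, b i
      = ∑ i with (i ≠ j ∧ ω.2 i = σ) ∧ p ≤ v i, coinSign (ω.1 i) * b i := by
    intro ω p
    have := sum_colourClass j ω σ v b p 1 (-1)
    unfold coinSign
    rw [← this]
    ring
  simp_rw [hsum, hdiff]
  set bad : (ι → Bool) → (ι → Bool) → Prop := fun u s =>
    κ * √(∑ i with (i ≠ j ∧ s i = σ) ∧ π (colourClass j (u, s) true !σ) ≤ v i, b i)
      < ∑ i with (i ≠ j ∧ s i = σ) ∧ π (colourClass j (u, s) true !σ) ≤ v i,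
        coinSign (u i) * b i with hbad
  set y := Real.exp (-(κ ^ 2 / (2 * β))) with hy
  -- Resampling the first coins on side `σ` by fresh coins `f` preserves the uniform law and leaves
  -- the opposite sample, hence the price, unchanged. For fixed `u` and `s` the set of agents who
  -- can afford the price is then deterministic, and the imbalance is a sum of independent signs in
  -- `f`.
  set flip : (ι → Bool) → (ι → Bool) → (ι → Bool) → (ι → Bool) := fun s f u i =>
    if s i = σ then xor (u i) (f i) else u i with hflip
  have hinv : ∀ s f, Function.Involutive (flip s f) := by
    intro s f u
    ext i
    simp only [hflip]
    split_ifs <;> simp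
  have hfixed : ∀ s u : ι → Bool,
      ((Finset.univ.filter fun f : ι → Bool => bad (flip s f u) s).card : ℝ)
        ≤ Fintype.card (ι → Bool) * y := by
    intro s u
    have hclass : ∀ f, colourClass j (flip s f u, s) true (!σ) = colourClass j (u, s) true !σ := by
      intro f
      unfold colourClass
      refine Finset.filter_congr fun i _ => ?_
      simp only [hflip]
      by_cases h : s i = σ
      · simp [h]
      · simp [h]
    set p := π (colourClass j (u, s) true !σ) with hp
    set T := Finset.univ.filter fun i => (i ≠ j ∧ s i = σ) ∧ p ≤ v i with hT
    set W := ∑ i ∈ T, b i with hW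
    have hmemT : ∀ i ∈ T, i ≠ j ∧ s i = σ := fun i hi => (Finset.mem_filter.1 hi).2.1
    set w : ι → ℝ := fun i => if i ∈ T then -coinSign (u i) * b i else 0 with hw
    have hbadiff : ∀ f, bad (flip s f u) s ↔ κ * √W < ∑ i, coinSign (f i) * w i := by
      intro f
      simp only [hbad]
      rw [hclass, ← hp, ← hT, ← hW]
      have : ∑ i ∈ T, coinSign (flip s f u i) * b i = ∑ i, coinSign (f i) * w i := by
        simp only [hw, mul_ite, mul_zero]
        rw [Finset.sum_ite_mem, Finset.univ_inter]
        refine Finset.sum_congr rfl fun i hi => ?_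
        have : flip s f u i = xor (u i) (f i) := by simp [hflip, (hmemT i hi).2]
        rw [this]
        cases u i <;> cases f i <;> simp [coinSign]
      rw [this]
    have hW0 : 0 ≤ W := Finset.sum_nonneg fun i _ => hb i
    -- Hoeffding's inequality is stated for positive variance. If `W = 0`, the strict inequality in
    -- the bad event reads `0 < 0`.
    rcases hW0.eq_or_lt with h0 | hpos
    · have hb0 : ∀ i ∈ T, b i = 0 :=
        (Finset.sum_eq_zero_iff_of_nonneg fun i _ => hb i).1 (hW ▸ h0.symm)
      have hw0 : ∀ i, w i = 0 := by
        intro i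
        simp only [hw]
        split_ifs with h
        · rw [hb0 i h, mul_zero]
        · rfl
      have : (Finset.univ.filter fun f : ι → Bool => bad (flip s f u) s) = ∅ := by
        ext f
        simp [hbadiff, ← h0, hw0]
      rw [this]
      simp only [Finset.card_empty, Nat.cast_zero]
      positivity
    · have hw2 : ∑ i, w i ^ 2 ≤ β * W := by
        rw [hW, Finset.mul_sum, ← Finset.univ_inter T, ← Finset.sum_ite_mem]
        refine Finset.sum_le_sum fun i _ => ?_
        simp only [hw]
        split_ifs with h
        · have h1 := hbβ i (hmemT i h).1
          have h2 := hb i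
          have h3 : (-coinSign (u i) * b i) ^ 2 = b i * b i := by
            cases u i <;> simp [coinSign] <;> ring
          rw [h3]
          gcongr
        · simp
      have := card_coinSign_sum_ge_le w (V := β * W) (t := κ * √W) (by positivity)
        (by positivity) hw2
      -- The threshold is normalized by `√W`, so the unknown total demand `W` cancels.
      have hexp : (κ * √W) ^ 2 / (2 * (β * W)) = κ ^ 2 / (2 * β) := by
        rw [mul_pow, Real.sq_sqrt hW0]
        field_simp
      rw [hexp] at this
      refine le_trans ?_ this
      gcongr with f _
      intro hf
      exact ((hbadiff f).1 hf).le
  have hside : ∀ s : ι → Bool, ((Finset.univ.filter fun u : ι → Bool => bad u s).card : ℝ)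
      ≤ Fintype.card (ι → Bool) * y := by
    intro s
    have hc0 : (0 : ℝ) < Fintype.card (ι → Bool) := by exact_mod_cast Fintype.card_pos
    refine le_of_mul_le_mul_left ?_ hc0
    have hind : ∀ Q : (ι → Bool) → Prop,
        ((Finset.univ.filter Q).card : ℝ) = ∑ u, if Q u then (1 : ℝ) else 0 := by
      intro Q
      rw [Finset.sum_boole]
    -- Double counting over `f` and `u`: for fixed `f` the flip is a bijection, for fixed `u` the
    -- Hoeffding bound applies.
    calc (Fintype.card (ι → Bool) : ℝ) * (Finset.univ.filter fun u => bad u s).card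
        = ∑ f : ι → Bool, ∑ u, if bad (flip s f u) s then (1 : ℝ) else 0 := by
          have : ∀ f : ι → Bool, (∑ u, if bad (flip s f u) s then (1 : ℝ) else 0)
              = (Finset.univ.filter fun u => bad u s).card := by
            intro f
            rw [hind]
            exact Equiv.sum_comp (hinv s f).toPerm fun u => if bad u s then (1 : ℝ) else 0
          simp_rw [this]
          rw [Finset.sum_const, Finset.card_univ, nsmul_eq_mul]
      _ = ∑ u : ι → Bool, ∑ f : ι → Bool, if bad (flip s f u) s then (1 : ℝ) else 0 :=
          Finset.sum_comm
      _ ≤ ∑ _u : ι → Bool, Fintype.card (ι → Bool) * y := by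
          refine Finset.sum_le_sum fun u _ => ?_
          rw [← hind]
          exact hfixed s u
      _ = _ := by rw [Finset.sum_const, Finset.card_univ, nsmul_eq_mul]
  calc ((Finset.univ.filter fun ω : (ι → Bool) × (ι → Bool) => bad ω.1 ω.2).card : ℝ)
      = ∑ s : ι → Bool, ((Finset.univ.filter fun u : ι → Bool => bad u s).card : ℝ) := by
        rw [← Finset.sum_boole, Fintype.sum_prod_type_right]
        simp_rw [Finset.sum_boole]
    _ ≤ ∑ _s : ι → Bool, Fintype.card (ι → Bool) * y := Finset.sum_le_sum fun s _ => hside s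
    _ = _ := by
        rw [Finset.sum_const, Finset.card_univ, nsmul_eq_mul, Fintype.card_prod]
        push_cast
        ring

end Concentration

/-! ### The law of the partition given the pivot agent -/

section Law

/-- Maps with constant fibre sizes over `T` push the uniform laws on `A` and `B` to the uniform law
on `T`, so the event `E` has the same probability under both. The identity is cross-multiplied to
stay in `ℕ`. -/
theorem card_filter_mul_card_of_const_fibers {α β γ : Type} [DecidableEq γ] (A : Finset α)
    (B : Finset β) (T : Finset γ) (f : α → γ) (g : β → γ) (hf : ∀ x ∈ A, f x ∈ T)
    (hg : ∀ x ∈ B, g x ∈ T) (z z' : ℕ) (hz : ∀ c ∈ T, (A.filter fun x => f x = c).card = z)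
    (hz' : ∀ c ∈ T, (B.filter fun x => g x = c).card = z') (E : γ → Prop) [DecidablePred E] :
    (A.filter fun x => E (f x)).card * B.card = A.card * (B.filter fun x => E (g x)).card := by
  have key : ∀ {δ : Type} (C : Finset δ) (h : δ → γ), (∀ x ∈ C, h x ∈ T) → ∀ y : ℕ,
      (∀ c ∈ T, (C.filter fun x => h x = c).card = y) →
      C.card = T.card * y ∧ (C.filter fun x => E (h x)).card = (T.filter E).card * y := by
    intro δ C h hC y hy
    constructor
    · rw [Finset.card_eq_sum_card_fiberwise hC, Finset.sum_congr rfl hy, Finset.sum_const,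
        smul_eq_mul]
    · rw [Finset.card_eq_sum_card_fiberwise (f := h) (t := T.filter E), Finset.sum_congr rfl
        (g := fun _ => y), Finset.sum_const, smul_eq_mul]
      · intro c hc
        rw [Finset.mem_filter] at hc
        rw [← hy c hc.1, Finset.filter_filter]
        congr 1
        refine Finset.filter_congr fun x _ => ?_
        constructor
        · exact fun h => h.2
        · rintro rfl
          exact ⟨hc.2, rfl⟩
      · intro x hx
        have hx' := Finset.mem_filter.1 hx
        exact Finset.mem_filter.2 ⟨hC x hx'.1, hx'.2⟩
  obtain ⟨h1, h2⟩ := key A f hf z hz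
  obtain ⟨h3, h4⟩ := key B g hg z' hz'
  rw [h1, h2, h3, h4]
  ring

/-- Two finite sets of the same size that do not contain `j` are exchanged by a permutation
that fixes `j`. -/
theorem exists_perm_image_eq {ι : Type} [Fintype ι] [DecidableEq ι] {j : ι} {S S' : Finset ι}
    (h : S.card = S'.card) (hS : j ∉ S) (hS' : j ∉ S') :
    ∃ π : Equiv.Perm ι, π j = j ∧ ∀ i, π i ∈ S' ↔ i ∈ S := by
  set π := (Finset.equivOfCardEq h : S ≃ S').extendSubtype with hπ
  have h1 : ∀ i, π i ∈ S' ↔ i ∈ S := by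
    intro i
    constructor
    · intro hi
      by_contra hn
      exact (Finset.equivOfCardEq h : S ≃ S').extendSubtype_not_mem i hn hi
    · exact fun hi => (Finset.equivOfCardEq h : S ≃ S').extendSubtype_mem i hi
  have h2 : π j ∉ S' := fun hj => hS ((h1 j).1 hj)
  refine ⟨π.trans (Equiv.swap (π j) j), by simp, fun i => ?_⟩
  rw [← h1 i, Equiv.trans_apply]
  by_cases hi : π i = π j
  · rw [hi, Equiv.swap_apply_left]
    exact iff_of_false hS' h2
  · by_cases hi' : π i = j
    · rw [hi', Equiv.swap_apply_right]
      exact iff_of_false h2 hS'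
    · rw [Equiv.swap_apply_of_ne_of_ne hi hi']

variable {n : ℕ}

/-- The arrival orders in which `j` has position `k` and is preceded by the set `S`. -/
def ordersWith (j k : Fin (n + 1)) (S : Finset (Fin (n + 1))) :
    Finset (Equiv.Perm (Fin (n + 1))) :=
  Finset.univ.filter fun o => o k = j ∧ (Finset.univ.filter fun i => o.symm i < k) = S

theorem card_filter_symm_lt (o : Equiv.Perm (Fin (n + 1))) (k : Fin (n + 1)) :
    (Finset.univ.filter fun i => o.symm i < k).card = k := by
  rw [← Fin.card_Iio k]
  refine Finset.card_nbij' o.symm o ?_ ?_ ?_ ?_ <;> simp [Set.MapsTo, Set.LeftInvOn]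

theorem card_ordersWith_eq {j k : Fin (n + 1)} {S S' : Finset (Fin (n + 1))}
    (h : S.card = S'.card) (hS : j ∉ S) (hS' : j ∉ S') :
    (ordersWith j k S).card = (ordersWith j k S').card := by
  obtain ⟨π, hπj, hπ⟩ := exists_perm_image_eq h hS hS'
  have hπs : π.symm j = j := by rw [Equiv.symm_apply_eq, hπj]
  have hπ' : ∀ i, π.symm i ∈ S ↔ i ∈ S' := fun i => by rw [← hπ, Equiv.apply_symm_apply]
  refine Finset.card_nbij' (fun o => o.trans π) (fun o => o.trans π.symm) ?_ ?_ ?_ ?_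
  · intro o ho
    simp only [ordersWith, Finset.coe_filter, Finset.mem_univ, true_and, Set.mem_ofPred_eq]
      at ho ⊢
    refine ⟨by simp [ho.1, hπj], ?_⟩
    ext i
    have := Finset.ext_iff.1 ho.2 (π.symm i)
    simp only [Finset.mem_filter, Finset.mem_univ, true_and] at this ⊢
    rw [Equiv.symm_trans_apply, this, hπ']
  · intro o ho
    simp only [ordersWith, Finset.coe_filter, Finset.mem_univ, true_and, Set.mem_ofPred_eq]
      at ho ⊢
    refine ⟨by simp [ho.1, hπs], ?_⟩
    ext i
    have := Finset.ext_iff.1 ho.2 (π i)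
    simp only [Finset.mem_filter, Finset.mem_univ, true_and] at this ⊢
    rw [Equiv.symm_trans_apply, Equiv.symm_symm, this, hπ]
  · intro o _; ext; simp
  · intro o _; ext; simp

theorem card_orders_position (j k k' : Fin (n + 1)) :
    (Finset.univ.filter fun o : Equiv.Perm (Fin (n + 1)) => o k = j).card
      = (Finset.univ.filter fun o : Equiv.Perm (Fin (n + 1)) => o k' = j).card := by
  refine Finset.card_nbij' (fun o => (Equiv.swap k k').trans o)
    (fun o => (Equiv.swap k k').trans o) ?_ ?_ ?_ ?_
  · intro o ho; simpa using ho
  · intro o ho; simpa using ho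
  · intro o _; ext; simp
  · intro o _; ext; simp

/-- By relabelling, the orders with `j` in position `k` split evenly among the possible sets of
predecessors. -/
theorem choose_mul_card_ordersWith {j k : Fin (n + 1)} {S : Finset (Fin (n + 1))}
    (hS : j ∉ S) (hk : S.card = k) :
    n.choose k * (ordersWith j k S).card
      = (Finset.univ.filter fun o : Equiv.Perm (Fin (n + 1)) => o k = j).card := by
  have hcard : ((Finset.univ.erase j).powersetCard (k : ℕ)).card = n.choose k := by
    rw [Finset.card_powersetCard, Finset.card_erase_of_mem (Finset.mem_univ j),
      Finset.card_univ, Fintype.card_fin, Nat.add_sub_cancel]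
  rw [Finset.card_eq_sum_card_fiberwise
    (s := Finset.univ.filter fun o : Equiv.Perm (Fin (n + 1)) => o k = j)
    (f := fun o : Equiv.Perm (Fin (n + 1)) => Finset.univ.filter fun i => o.symm i < k)
    (t := (Finset.univ.erase j).powersetCard (k : ℕ))]
  · rw [← hcard]
    refine Eq.trans (by rw [Finset.sum_const, smul_eq_mul]) (Finset.sum_congr rfl
      (f := fun _ => (ordersWith j k S).card) fun S' hS' => ?_)
    rw [Finset.mem_powersetCard] at hS'
    rw [card_ordersWith_eq (hk.trans hS'.2.symm) hS fun hj => by simpa using hS'.1 hj,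
      Finset.filter_filter]
    rfl
  · intro o ho
    have ho' : o k = j := by simpa using ho
    simp only [Finset.mem_coe, Finset.mem_powersetCard]
    refine ⟨fun i hi => ?_, card_filter_symm_lt o k⟩
    simp only [Finset.mem_filter, Finset.mem_univ, true_and] at hi
    simp only [Finset.mem_erase, Finset.mem_univ, and_true]
    rintro rfl
    rw [← ho'] at hi
    simp at hi

theorem card_coins_with_tails (k : ℕ) :
    (Finset.univ.filter fun c : Fin n → Bool =>
      (Finset.univ.filter fun l => c l = false).card = k).card = n.choose k := by
  have : ((Finset.univ : Finset (Fin n)).powersetCard k).card = n.choose k := by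
    rw [Finset.card_powersetCard, Finset.card_univ, Fintype.card_fin]
  rw [← this]
  refine Finset.card_nbij' (fun c => Finset.univ.filter fun l => c l = false)
    (fun S l => decide (l ∉ S)) ?_ ?_ ?_ ?_
  · intro c hc
    simpa [Finset.mem_powersetCard] using hc
  · intro S hS
    simpa [Finset.mem_powersetCard] using hS
  · intro c _
    ext l
    simp
  · intro S _
    ext l
    simp

namespace Draw

/-- The agents that arrive before the pivot agent. -/
def before (D : Draw n) : Finset (Fin (n + 1)) :=
  Finset.univ.filter fun i => D.order.symm i < D.pivotSlot

/-- The sides of the agents. -/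
def sideOf (D : Draw n) (i : Fin (n + 1)) : Bool := D.side (D.order.symm i)

end Draw

/-- The side coins are forced by `τ`. Exactly `n.choose S.card` toss sequences place the pivot right
after `S.card` agents, and a fraction `1 / n.choose S.card` of the orders with `j` in that slot has
`S` in front. The binomial coefficients cancel, so the count does not depend on `S`. -/
theorem card_draws_fiber (j : Fin (n + 1)) (S : Finset (Fin (n + 1))) (hS : j ∉ S)
    (τ : Fin (n + 1) → Bool) :
    ((Finset.univ.filter fun D : Draw n => D.pivot = j).filter fun D =>
        (D.before, D.sideOf) = (S, τ)).card
      = (Finset.univ.filter fun o : Equiv.Perm (Fin (n + 1)) => o 0 = j).card := by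
  classical
  set tails : (Fin n → Bool) → ℕ := fun c => (Finset.univ.filter fun l => c l = false).card
  have htails : ∀ c, tails c < n + 1 := fun c =>
    Nat.lt_succ_of_le ((Finset.card_le_univ _).trans (Fintype.card_fin n).le)
  have hSn : S.card < n + 1 := by
    have := Finset.card_lt_univ_of_notMem hS
    simpa using this
  set k : Fin (n + 1) := ⟨S.card, hSn⟩ with hk
  have hbij : ((Finset.univ.filter fun D : Draw n => D.pivot = j).filter fun D =>
        (D.before, D.sideOf) = (S, τ)).card
      = ((ordersWith j k S) ×ˢ (Finset.univ.filter fun c : Fin n → Bool =>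
          tails c = S.card)).card := by
    refine Finset.card_nbij' (fun D => (D.order, D.coin))
      (fun q => ⟨q.1, q.2, fun s => τ (q.1 s)⟩) ?_ ?_ ?_ ?_
    · intro D hD
      simp only [Finset.coe_filter, Finset.mem_filter, Finset.mem_univ, true_and,
        Set.mem_ofPred_eq, Prod.mk.injEq] at hD
      obtain ⟨h1, h2, -⟩ := hD
      have h3 : (D.pivotSlot : ℕ) = S.card := by
        rw [← h2]
        exact (card_filter_symm_lt D.order D.pivotSlot).symm
      have h4 : D.pivotSlot = k := Fin.ext h3
      simp only [Finset.coe_product, Set.mem_prod, Finset.mem_coe, ordersWith,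
        Finset.mem_filter, Finset.mem_univ, true_and]
      rw [← h4]
      exact ⟨⟨h1, h2⟩, h3⟩
    · rintro ⟨o, c⟩ hq
      simp only [Finset.coe_product, Set.mem_prod, Finset.mem_coe, ordersWith,
        Finset.mem_filter, Finset.mem_univ, true_and] at hq
      obtain ⟨⟨h1, h2⟩, h3⟩ := hq
      set D : Draw n := ⟨o, c, fun s => τ (o s)⟩ with hD
      have h4 : D.pivotSlot = k := Fin.ext h3
      simp only [Finset.coe_filter, Finset.mem_filter, Finset.mem_univ, true_and,
        Set.mem_ofPred_eq, Prod.mk.injEq]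
      refine ⟨?_, ?_, ?_⟩
      · rw [Draw.pivot, h4]; exact h1
      · rw [Draw.before, h4]; exact h2
      · ext i; simp [Draw.sideOf]
    · intro D hD
      simp only [Finset.coe_filter, Finset.mem_filter, Finset.mem_univ, true_and,
        Set.mem_ofPred_eq, Prod.mk.injEq] at hD
      obtain ⟨-, -, h⟩ := hD
      obtain ⟨o, c, s⟩ := D
      simp only [Draw.mk.injEq, true_and]
      ext t
      rw [← h]
      simp [Draw.sideOf]
    · intro q _
      rfl
  rw [hbij, Finset.card_product, card_coins_with_tails, mul_comm]
  exact (choose_mul_card_ordersWith (k := k) hS rfl).trans (card_orders_position j k 0)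

/-- Only the first coin of `j` is left free, which accounts for the 2. -/
theorem card_colourings_fiber (j : Fin (n + 1)) (S : Finset (Fin (n + 1))) (hS : j ∉ S)
    (τ : Fin (n + 1) → Bool) :
    ((Finset.univ : Finset ((Fin (n + 1) → Bool) × (Fin (n + 1) → Bool))).filter fun ω =>
        ((Finset.univ.filter fun i => i ≠ j ∧ ω.1 i = true), ω.2) = (S, τ)).card = 2 := by
  classical
  rw [Finset.card_eq_two]
  refine ⟨(fun i => decide (i ∈ S), τ), (fun i => decide (i ∈ insert j S), τ), ?_, ?_⟩
  · intro h
    have := congrFun (congrArg Prod.fst h) j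
    simp [hS] at this
  · ext ⟨u, s⟩
    simp only [Finset.mem_filter, Finset.mem_univ, true_and, Prod.mk.injEq, Finset.mem_insert,
      Finset.mem_singleton]
    constructor
    · rintro ⟨h1, rfl⟩
      have h2 : ∀ i, i ≠ j → u i = decide (i ∈ S) := by
        intro i hi
        rw [← h1]
        simp [hi]
      cases hu : u j
      · left
        refine ⟨funext fun i => ?_, rfl⟩
        by_cases hi : i = j
        · subst hi; simp [hu, hS]
        · exact h2 i hi
      · right
        refine ⟨funext fun i => ?_, rfl⟩
        by_cases hi : i = j
        · subst hi; simp [hu]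
        · simp [h2 i hi, hi]
    · rintro (⟨rfl, rfl⟩ | ⟨rfl, rfl⟩)
      · refine ⟨?_, rfl⟩
        ext i
        by_cases hi : i = j
        · subst hi; simp [hS]
        · simp [hi]
      · refine ⟨?_, rfl⟩
        ext i
        by_cases hi : i = j
        · subst hi; simp [hS]
        · simp [hi]

/-- Given that `j` is the pivot agent, the partition of the other agents is uniformly random. -/
theorem card_draws_mul_card_colourings (j : Fin (n + 1))
    (E : Finset (Fin (n + 1)) × (Fin (n + 1) → Bool) → Prop) [DecidablePred E] :
    ((Finset.univ.filter fun D : Draw n => D.pivot = j).filter fun D =>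
        E (D.before, D.sideOf)).card
        * Fintype.card ((Fin (n + 1) → Bool) × (Fin (n + 1) → Bool))
      = (Finset.univ.filter fun D : Draw n => D.pivot = j).card *
        ((Finset.univ : Finset ((Fin (n + 1) → Bool) × (Fin (n + 1) → Bool))).filter fun ω =>
          E ((Finset.univ.filter fun i => i ≠ j ∧ ω.1 i = true), ω.2)).card := by
  rw [← Finset.card_univ]
  refine card_filter_mul_card_of_const_fibers _ _
    (Finset.univ.filter fun c : Finset (Fin (n + 1)) × (Fin (n + 1) → Bool) => j ∉ c.1)
    (fun D : Draw n => (D.before, D.sideOf))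
    (fun ω : (Fin (n + 1) → Bool) × (Fin (n + 1) → Bool) =>
      ((Finset.univ.filter fun i => i ≠ j ∧ ω.1 i = true), ω.2)) ?_ ?_
    (Finset.univ.filter fun o : Equiv.Perm (Fin (n + 1)) => o 0 = j).card 2 ?_ ?_ E
  · intro D hD
    rw [Finset.mem_filter] at hD
    simp [Draw.before, ← hD.2, Draw.pivot]
  · intro ω _
    simp
  · rintro ⟨S, τ⟩ hc
    exact card_draws_fiber j S (Finset.mem_filter.1 hc).2 τ
  · rintro ⟨S, τ⟩ hc
    exact card_colourings_fiber j S (Finset.mem_filter.1 hc).2 τ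

theorem card_pivot_eq_pos (j : Fin (n + 1)) :
    0 < (Finset.univ.filter fun D : Draw n => D.pivot = j).card := by
  rw [Finset.card_pos]
  set D : Draw n := ⟨1, fun _ => false, fun _ => false⟩
  refine ⟨⟨Equiv.swap D.pivotSlot j, fun _ => false, fun _ => false⟩, ?_⟩
  simp only [Finset.mem_filter, Finset.mem_univ, true_and]
  exact Equiv.swap_apply_left _ _

theorem cond_drawLaw_pivot (j : Fin (n + 1)) (E : Set (Draw n)) [DecidablePred (· ∈ E)] :
    ProbabilityTheory.cond (drawLaw n) {D | D.pivot = j} E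
      = (((Finset.univ.filter fun D : Draw n => D.pivot = j).filter fun D => D ∈ E).card : ℝ≥0∞)
        / (Finset.univ.filter fun D : Draw n => D.pivot = j).card := by
  have hmeas : ∀ (s : Set (Draw n)) [DecidablePred (· ∈ s)], drawLaw n s
      = ((Finset.univ.filter fun D => D ∈ s).card : ℝ≥0∞) / Fintype.card (Draw n) := by
    intro s _
    rw [drawLaw, PMF.toMeasure_uniformOfFintype_apply s MeasurableSpace.measurableSet_top, Fintype.card_subtype]
  rw [ProbabilityTheory.cond_apply MeasurableSpace.measurableSet_top, hmeas, hmeas]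
  have hN : (Fintype.card (Draw n) : ℝ≥0∞) ≠ 0 := by simp
  have hZ : ((Finset.univ.filter fun D : Draw n => D.pivot = j).card : ℝ≥0∞) ≠ 0 := by
    exact_mod_cast (card_pivot_eq_pos j).ne'
  have e : (Finset.univ.filter fun D : Draw n => D ∈ {D : Draw n | D.pivot = j} ∩ E)
      = (Finset.univ.filter fun D : Draw n => D.pivot = j).filter fun D => D ∈ E := by
    rw [Finset.filter_filter]
    rfl
  rw [e, ENNReal.inv_div (by simp) (by simp)]
  simp only [Set.mem_ofPred_eq]
  rw [← ENNReal.mul_div_right_comm, ENNReal.mul_div_cancel hN (by simp)]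

end Law

/-! ### The revenue guarantee -/

/-- `G` is the value of the supply at the offered price, and `α` and `β` are the sampled and later
demands at that price. Balance forces `β ≥ ρ * α` with `ρ = 1 - 6 / 5 * δ`, and then about a third
of `ρ * min G α` is earned. -/
theorem revenue_bound_of_balanced {δ O G α β : ℝ} (hδ : 0 < δ) (hδ' : δ ≤ 1 / 3) (hO : 0 < O)
    (hG : O / 4 - 3 * δ * O / 16 ≤ G) (hα : O / 4 - 3 * δ * O / 16 ≤ α)
    (hαβ : α - β ≤ δ * √(O / 8) * √(α + β)) :
    0 < G * (1 - Real.exp (-(β / (2 * max G α)))) ∧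
      (1 - 3 * δ) * O / 16 < G * (1 - Real.exp (-(β / (2 * max G α)))) := by
  have hg : 3 / 16 * O ≤ O / 4 - 3 * δ * O / 16 := by nlinarith
  have hα0 : 0 < α := by linarith
  have hG0 : 0 < G := by linarith
  set ρ := 1 - 6 / 5 * δ with hρ
  have hρ0 : 3 / 5 ≤ ρ := by linarith
  -- Otherwise `α - β > 6 / 5 * δ * α` and `β ≤ α`, so `36 / 25 * α ^ 2 < O * α / 4`. This
  -- contradicts `α ≥ 3 / 16 * O`, as `25 / 144 < 3 / 16`.
  have hβα : ρ * α ≤ β := by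
    by_contra hlt
    push Not at hlt
    have h1 : 6 / 5 * α < √(O / 8) * √(α + β) := by
      have : δ * (6 / 5 * α) < δ * (√(O / 8) * √(α + β)) := by nlinarith
      exact lt_of_mul_lt_mul_left this hδ.le
    rw [← Real.sqrt_mul (by positivity)] at h1
    have h2 := (Real.lt_sqrt (by positivity)).1 h1
    have h3 : β ≤ α := by nlinarith
    nlinarith
  have hβ0 : 0 < β := lt_of_lt_of_le (by positivity) hβα
  set Q := max G α with hQ
  have hQ0 : 0 < Q := lt_max_of_lt_left hG0
  set x := β / (2 * Q) with hx
  have hx0 : 0 ≤ x := by positivity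
  have hexp : β / (2 * Q + β) ≤ 1 - Real.exp (-x) := by
    have h1 : Real.exp (-x) ≤ 1 / (1 + x) := by
      rw [Real.exp_neg, ← one_div]
      exact one_div_le_one_div_of_le (by positivity) (by linarith [Real.add_one_le_exp x])
    have h2 : β / (2 * Q + β) = 1 - 1 / (1 + x) := by
      rw [hx]
      field_simp
      ring
    linarith
  -- The right side increases with `β`, so `β` may be lowered to `ρ * α`. Then `2 * Q + ρ * α ≤ 3 *
  -- Q`, and `G * α` is `Q` times the smaller of `G` and `α`.
  have hgρ : ρ * (O / 4 - 3 * δ * O / 16) / 3 ≤ G * (β / (2 * Q + β)) := by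
    rw [mul_div_assoc', le_div_iff₀ (by positivity)]
    set g := O / 4 - 3 * δ * O / 16 with hgdef
    have hmono : ρ * g / 3 * (2 * Q + ρ * α) ≤ G * (ρ * α) → ρ * g / 3 * (2 * Q + β) ≤ G * β := by
      intro h
      have : ρ * g / 3 * (β - ρ * α) ≤ G * (β - ρ * α) := by
        refine mul_le_mul_of_nonneg_right ?_ (by linarith)
        nlinarith
      linarith
    apply hmono
    have hQ' : 2 * Q + ρ * α ≤ 3 * Q := by
      have : α ≤ Q := le_max_right _ _
      nlinarith
    have hgQ : g * Q ≤ G * α := by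
      rcases le_total G α with h | h
      · rw [hQ, max_eq_right h]; gcongr
      · rw [hQ, max_eq_left h, mul_comm]; gcongr
    have hg0 : 0 ≤ g := by linarith
    calc ρ * g / 3 * (2 * Q + ρ * α) ≤ ρ * g / 3 * (3 * Q) := by gcongr
      _ = ρ * (g * Q) := by ring
      _ ≤ ρ * (G * α) := by gcongr
      _ = _ := by ring
  have hlow : ρ * (O / 4 - 3 * δ * O / 16) / 3 ≤ G * (1 - Real.exp (-x)) :=
    hgρ.trans (by gcongr)
  refine ⟨lt_of_lt_of_le ?_ hlow, lt_of_lt_of_le ?_ hlow⟩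
  · have : 0 < O / 4 - 3 * δ * O / 16 := by linarith
    positivity
  -- Multiplied by `48 / O`, the claim is `3 - 9 * δ < 4 - 39 / 5 * δ + 18 / 5 * δ ^ 2`.
  · have h1 : 0 < δ * O := by positivity
    have h2 : 0 < δ * (δ * O) := by positivity
    rw [hρ]
    nlinarith

/-! ### Balanced partitions, their probability and their revenue. -/

section Balanced

variable {n : ℕ}

/-- Sampled agents on side `σ`, for the sampling set and the sides `q`. -/
def sampleOf (q : Finset (Fin (n + 1)) × (Fin (n + 1) → Bool)) (σ : Bool) :
    Finset (Fin (n + 1)) :=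
  q.1.filter fun i => q.2 i = σ

/-- Later agents on side `σ`, for the sampling set and the sides `q` and the pivot agent `j`. -/
def laterOf (j : Fin (n + 1)) (q : Finset (Fin (n + 1)) × (Fin (n + 1) → Bool)) (σ : Bool) :
    Finset (Fin (n + 1)) :=
  Finset.univ.filter fun i => i ≠ j ∧ i ∉ q.1 ∧ q.2 i = σ

theorem Draw.sample_eq_sampleOf (D : Draw n) (σ : Bool) :
    D.sample σ = sampleOf (D.before, D.sideOf) σ := by
  ext i
  rw [Draw.mem_sample, sampleOf, Finset.mem_filter, Draw.before, Finset.mem_filter]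
  simp [Draw.sideOf]

theorem Draw.later_eq_laterOf (D : Draw n) (σ : Bool) :
    D.later σ = laterOf D.pivot (D.before, D.sideOf) σ := by
  ext i
  have h : i = D.pivot ↔ D.order.symm i = D.pivotSlot := by
    rw [Draw.pivot, Equiv.symm_apply_eq]
  simp only [Draw.later, laterOf, Draw.before, Draw.sideOf, Finset.mem_filter, Finset.mem_univ,
    true_and, not_lt, ne_eq, h, ← and_assoc]
  refine and_congr_left fun _ => ?_
  rw [lt_iff_le_and_ne, and_comm]
  exact and_congr_left fun _ => ⟨fun h => h.symm, fun h => Ne.symm h⟩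

theorem colourClass_true_eq (j : Fin (n + 1)) (ω : (Fin (n + 1) → Bool) × (Fin (n + 1) → Bool))
    (σ : Bool) : colourClass j ω true σ
      = sampleOf ((Finset.univ.filter fun i => i ≠ j ∧ ω.1 i = true), ω.2) σ := by
  ext i
  simp [colourClass, sampleOf, and_assoc]

theorem colourClass_false_eq (j : Fin (n + 1)) (ω : (Fin (n + 1) → Bool) × (Fin (n + 1) → Bool))
    (σ : Bool) : colourClass j ω false σ
      = laterOf j ((Finset.univ.filter fun i => i ≠ j ∧ ω.1 i = true), ω.2) σ := by
  ext i
  simp only [colourClass, laterOf, Finset.mem_filter, Finset.mem_univ, true_and, not_and,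
    Bool.not_eq_true]
  refine and_congr_right fun h => and_congr_left fun _ => ?_
  simp [h]

/-- The weights `c` of both samples exceed `g`, and at the price of the opposite sample the
demand of a sample exceeds the demand of the later agents on its side by little. -/
def Balanced (v b : Fin (n + 1) → ℝ) (P : Finset (Fin (n + 1)) → ℝ) (j : Fin (n + 1))
    (c : Fin (n + 1) → ℝ) (g κ : ℝ) (q : Finset (Fin (n + 1)) × (Fin (n + 1) → Bool)) : Prop :=
  ∀ σ, g < ∑ i ∈ sampleOf q σ, c i ∧
    ∑ i ∈ sampleOf q σ with P (sampleOf q !σ) ≤ v i, b i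
        - ∑ i ∈ laterOf j q σ with P (sampleOf q !σ) ≤ v i, b i
      ≤ κ * √(∑ i ∈ sampleOf q σ with P (sampleOf q !σ) ≤ v i, b i
        + ∑ i ∈ laterOf j q σ with P (sampleOf q !σ) ≤ v i, b i)

-- A union bound over four bad events: too little weight in a sample, or too large an imbalance, on
-- either side.
open Classical in
theorem le_card_balanced (v b : Fin (n + 1) → ℝ) (hb : ∀ i, 0 ≤ b i)
    (P : Finset (Fin (n + 1)) → ℝ) (j : Fin (n + 1)) {c : Fin (n + 1) → ℝ} (hc : ∀ i, 0 ≤ c i)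
    (hcj : c j = 0) (hcb : ∀ i, c i ≤ b i) {O ε δ : ℝ} (hcO : ∑ i, c i = O) (hO : 0 < O)
    (hε : 0 < ε) (hbε : ∀ i, i ≠ j → b i ≤ ε * O) (hδ : 0 ≤ δ) :
    (1 - 4 * Real.exp (-(δ ^ 2 / (16 * ε)))) *
        Fintype.card ((Fin (n + 1) → Bool) × (Fin (n + 1) → Bool))
      ≤ (((Finset.univ : Finset ((Fin (n + 1) → Bool) × (Fin (n + 1) → Bool))).filter fun ω =>
        Balanced v b P j c (O / 4 - 3 * δ * O / 16) (δ * √(O / 8))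
          ((Finset.univ.filter fun i => i ≠ j ∧ ω.1 i = true), ω.2)).card : ℝ) := by
  set Ω := (Fin (n + 1) → Bool) × (Fin (n + 1) → Bool)
  set y := Real.exp (-(δ ^ 2 / (16 * ε))) with hy
  set good : Ω → Prop := fun ω => Balanced v b P j c (O / 4 - 3 * δ * O / 16) (δ * √(O / 8))
          ((Finset.univ.filter fun i => i ≠ j ∧ ω.1 i = true), ω.2) with hgood
  set bad₁ : Bool → Ω → Prop := fun σ ω =>
    ∑ i with ω.1 i = true ∧ ω.2 i = σ, c i ≤ (∑ i, c i) / 4 - 3 * δ * O / 16 with hbad₁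
  set bad₂ : Bool → Ω → Prop := fun σ ω =>
    δ * √(O / 8) * √(∑ i ∈ colourClass j ω true σ with P (colourClass j ω true !σ) ≤ v i, b i
            + ∑ i ∈ colourClass j ω false σ with P (colourClass j ω true !σ) ≤ v i, b i)
          < ∑ i ∈ colourClass j ω true σ with P (colourClass j ω true !σ) ≤ v i, b i
            - ∑ i ∈ colourClass j ω false σ with P (colourClass j ω true !σ) ≤ v i, b i
    with hbad₂
  have h1 : ∀ σ, ((Finset.univ.filter (bad₁ σ)).card : ℝ) ≤ Fintype.card Ω * y := by
    intro σ
    have hV : ∑ i, c i ^ 2 ≤ ε * O ^ 2 := by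
      calc ∑ i, c i ^ 2 ≤ ∑ i, ε * O * c i := by
            refine Finset.sum_le_sum fun i _ => ?_
            by_cases hi : i = j
            · subst hi; simp [hcj]
            · rw [sq]
              exact mul_le_mul_of_nonneg_right ((hcb i).trans (hbε i hi)) (hc i)
        _ = ε * O ^ 2 := by rw [← Finset.mul_sum, hcO]; ring
    have := card_quarter_sum_le_le hc (V := ε * O ^ 2) (t := 3 * δ * O / 16) (by positivity)
      (by positivity) hV σ
    -- The deviation `3 * δ * O / 16` is just large enough: `2 * (3 / 16) ^ 2 = 9 / 128 ≥ 1 / 16`.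
    have hle : Real.exp (-(2 * (3 * δ * O / 16) ^ 2 / (ε * O ^ 2))) ≤ y := by
      rw [hy, Real.exp_le_exp, neg_le_neg_iff, div_le_div_iff₀ (by positivity) (by positivity)]
      have : 0 ≤ δ ^ 2 * (ε * O ^ 2) := by positivity
      nlinarith
    refine (le_trans (le_of_eq ?_) this).trans (by gcongr)
    congr!
  have h2 : ∀ σ, ((Finset.univ.filter (bad₂ σ)).card : ℝ) ≤ Fintype.card Ω * y := by
    intro σ
    have := card_imbalance_le j v b hb P σ (β := ε * O) (κ := δ * √(O / 8)) (by positivity) hbε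
      (by positivity)
    have hle : (δ * √(O / 8)) ^ 2 / (2 * (ε * O)) = δ ^ 2 / (16 * ε) := by
      rw [mul_pow, Real.sq_sqrt (by positivity)]
      field_simp
      ring
    rw [hle] at this
    refine le_trans (le_of_eq ?_) this
    congr!
  have hsub : (Finset.univ : Finset Ω) ⊆ Finset.univ.filter good ∪
      (Finset.univ.filter (bad₁ true) ∪ Finset.univ.filter (bad₁ false)) ∪
      (Finset.univ.filter (bad₂ true) ∪ Finset.univ.filter (bad₂ false)) := by
    intro ω _
    simp only [Finset.mem_union, Finset.mem_filter, Finset.mem_univ, true_and]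
    by_contra hcon
    push Not at hcon
    obtain ⟨⟨hng, h1t, h1f⟩, h2t, h2f⟩ := hcon
    apply hng
    have hb1 : ∀ σ, ¬ bad₁ σ ω := fun σ => by cases σ <;> assumption
    have hb2 : ∀ σ, ¬ bad₂ σ ω := fun σ => by cases σ <;> assumption
    intro σ
    have e1 := hb1 σ
    have e2 := hb2 σ
    simp only [hbad₁, hbad₂, not_le, not_lt] at e1 e2
    rw [← colourClass_true_eq, ← colourClass_true_eq, ← colourClass_false_eq]
    refine ⟨?_, e2⟩
    rw [hcO] at e1
    refine e1.trans_le (le_of_eq ?_)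
    unfold colourClass
    rw [Finset.sum_filter, Finset.sum_filter]
    refine Finset.sum_congr rfl fun i _ => ?_
    by_cases hi : i = j
    · subst hi; simp [hcj]
    · simp [hi]
  have hcard : (Fintype.card Ω : ℝ) ≤ (Finset.univ.filter good).card
      + ((Finset.univ.filter (bad₁ true)).card + (Finset.univ.filter (bad₁ false)).card)
      + ((Finset.univ.filter (bad₂ true)).card + (Finset.univ.filter (bad₂ false)).card) := by
    have e := Finset.card_le_card hsub
    rw [Finset.card_univ] at e
    have e1 := Finset.card_union_le (Finset.univ.filter good ∪
      (Finset.univ.filter (bad₁ true) ∪ Finset.univ.filter (bad₁ false)))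
      (Finset.univ.filter (bad₂ true) ∪ Finset.univ.filter (bad₂ false))
    have e2 := Finset.card_union_le (Finset.univ.filter good)
      (Finset.univ.filter (bad₁ true) ∪ Finset.univ.filter (bad₁ false))
    have e3 := Finset.card_union_le (Finset.univ.filter (bad₁ true))
      (Finset.univ.filter (bad₁ false))
    have e4 := Finset.card_union_le (Finset.univ.filter (bad₂ true))
      (Finset.univ.filter (bad₂ false))
    exact_mod_cast (by omega : Fintype.card Ω ≤ (Finset.univ.filter good).card
      + ((Finset.univ.filter (bad₁ true)).card + (Finset.univ.filter (bad₁ false)).card)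
      + ((Finset.univ.filter (bad₂ true)).card + (Finset.univ.filter (bad₂ false)).card))
  linarith [h1 true, h1 false, h2 true, h2 false]

/-- The optimal prices of samples of sufficient weight generate a high demand and are high. -/
theorem le_demand_and_supply_of_isOptPrice {v b : Fin (n + 1) → ℝ}
    {K p q g O : ℝ} {T : Finset (Fin (n + 1))} {c : Fin (n + 1) → ℝ}
    (hq : 0 < q) (hqK : O / 4 ≤ K * q) (hc : ∀ i ∈ T, c i ≤ if q ≤ v i then b i else 0)
    (hg : g ≤ O / 4) (hgc : g < ∑ i ∈ T, c i) (hp : IsOptPrice v b T K p) :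
    g ≤ ∑ i ∈ T with p ≤ v i, b i ∧ g ≤ p * K := by
  have hunif : ∀ r, 0 < r → uniformRevenue v b T K r
      = min (∑ i ∈ T with r ≤ v i, b i) (K * r) := by
    intro r hr
    unfold uniformRevenue
    rw [min_mul_of_nonneg _ _ hr.le, ← Finset.sum_div, div_mul_cancel₀ _ hr.ne']
  have h1 : g ≤ uniformRevenue v b T K q := by
    rw [hunif q hq]
    refine le_min ?_ (hg.trans hqK)
    rw [Finset.sum_filter]
    exact hgc.le.trans (Finset.sum_le_sum hc)
  have h2 := h1.trans (hp.2 q hq)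
  rw [hunif p hp.1] at h2
  exact ⟨h2.trans (min_le_left _ _), mul_comm K p ▸ h2.trans (min_le_right _ _)⟩

theorem lt_expectedRevenue_of_balanced {v b : Fin (n + 1) → ℝ} (hb : ∀ i, 0 ≤ b i)
    {P : Finset (Fin (n + 1)) → ℝ} {m : ℝ} {K : ℕ} (hmK : m / 4 = K)
    (hP : ∀ S, IsOptPrice v b S (m / 4) (P S)) (a d : Fin (n + 1) → ℝ)
    {c : Fin (n + 1) → ℝ} {q O ε δ : ℝ} (hO : 0 < O) (hq : 0 < q) (hqK : O / 4 ≤ K * q)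
    (hc : ∀ i, c i ≤ if q ≤ v i then b i else 0) (hδ : 0 < δ) (hδ' : δ ≤ 1 / 3)
    (hε : ε ≤ 3 / 16) (D : Draw n) (hbε : ∀ i, i ≠ D.pivot → b i ≤ ε * O)
    (hbal : Balanced v b P D.pivot c (O / 4 - 3 * δ * O / 16) (δ * √(O / 8))
      (D.before, D.sideOf)) :
    ENNReal.ofReal ((1 - 3 * δ) * O / 16) < expectedRevenue (revIndiv a d v b m P D) := by
  set g := O / 4 - 3 * δ * O / 16 with hg
  have hgO : 3 / 16 * O ≤ g := by nlinarith
  have hg0 : 0 < g := by linarith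
  have hg4 : g ≤ O / 4 := by
    have : 0 ≤ 3 * δ * O / 16 := by positivity
    linarith
  have hPpos : ∀ S, 0 < P S := fun S => (hP S).1
  unfold Balanced at hbal
  simp_rw [← Draw.sample_eq_sampleOf, ← Draw.later_eq_laterOf] at hbal
  have hopt : ∀ σ, g ≤ ∑ i ∈ D.sample σ with P (D.sample σ) ≤ v i, b i
      ∧ g ≤ P (D.sample σ) * K := fun σ =>
    le_demand_and_supply_of_isOptPrice hq hqK (fun i _ => hc i) hg4 (hbal σ).1 (hmK ▸ hP _)
  -- The side that is offered the lower price: lowering the price from its own optimal one can only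
  -- add buyers, so its sampled demand stays at least `g`.
  obtain ⟨σ, hσ⟩ : ∃ σ, P (D.sample !σ) ≤ P (D.sample σ) := by
    rcases le_total (P (D.sample true)) (P (D.sample false)) with h | h
    · exact ⟨false, h⟩
    · exact ⟨true, h⟩
  set p := P (D.sample !σ) with hp
  set α := ∑ i ∈ D.sample σ with p ≤ v i, b i with hα
  set β := ∑ i ∈ D.later σ with p ≤ v i, b i with hβ
  have hgG : g ≤ p * K := (hopt !σ).2
  have hgα : g ≤ α := by
    refine (hopt σ).1.trans (Finset.sum_le_sum_of_subset_of_nonneg ?_ fun i _ _ => hb i)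
    exact Finset.monotone_filter_right _ fun i _ hi => hσ.trans hi
  have hK : 0 < K := by
    rcases Nat.eq_zero_or_pos K with rfl | h
    · simp at hgG
      linarith
    · exact h
  have hnum := revenue_bound_of_balanced hδ hδ' hO hgG hgα (hbal σ).2
  have hrev := le_expectedRevenue hb hPpos hK hmK a d D σ hp (Q := max (p * K) α)
    (le_max_left _ _) (le_max_right _ _) fun i hi => by
      rw [Draw.later_eq_laterOf, laterOf, Finset.mem_filter] at hi
      -- No single later agent can exceed the supply: `b i ≤ ε * O ≤ 3 / 16 * O ≤ g ≤ p * K`.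
      refine (hbε i hi.2.1).trans (le_trans ?_ hgG)
      nlinarith
  exact lt_of_lt_of_le ((ENNReal.ofReal_lt_ofReal_iff hnum.1).2 hnum.2) hrev

end Balanced

/-- Weights below the budgets of the agents that can afford the price `q`, with total `O`. -/
theorem exists_weights {ι : Type} [Fintype ι] [DecidableEq ι] {v b : ι → ℝ}
    (hb : ∀ i, 0 ≤ b i) (j : ι) {q O : ℝ} (hO : 0 < O)
    (hOb : O ≤ ∑ i ∈ Finset.univ.erase j with q ≤ v i, b i) :
    ∃ c : ι → ℝ, (∀ i, 0 ≤ c i) ∧ c j = 0 ∧ (∀ i, c i ≤ if q ≤ v i then b i else 0) ∧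
      ∑ i, c i = O := by
  set B := ∑ i ∈ Finset.univ.erase j with q ≤ v i, b i with hB
  have hB0 : 0 < B := hO.trans_le hOb
  refine ⟨fun i => if i ∈ (Finset.univ.erase j).filter fun i => q ≤ v i then b i * (O / B)
    else 0, fun i => ?_, by simp, fun i => ?_, ?_⟩
  · dsimp only
    split_ifs
    · have := hb i
      positivity
    · exact le_rfl
  · have h1 : O / B ≤ 1 := by rwa [div_le_one hB0]
    by_cases hi : q ≤ v i
    · dsimp only
      rw [if_pos hi]
      split_ifs
      · exact mul_le_of_le_one_right (hb i) h1
      · exact hb i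
    · simp [hi]
  · rw [Finset.sum_ite_mem, Finset.univ_inter, ← Finset.sum_mul, ← hB]
    field_simp

end OnlineBudget

end

/-! ### Proof of the lemma. -/

theorem mainTheorem4 (n m : ℕ) (hm : 4 ∣ m)
    (a d v b : Fin (n + 1) → ℝ)
    (ha : StrictMono a) (had : ∀ s, a s ≤ d s)
    (hv : ∀ i, 0 ≤ v i) (hb : ∀ i, 0 ≤ b i)
    (P : Finset (Fin (n + 1)) → ℝ)
    (hP : ∀ S, OnlineBudget.IsOptPrice v b S ((m : ℝ) / 4) (P S))
    (j : Fin (n + 1))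
    (OPT' ε' : ℝ)
    (hOPT' : OPT' = OnlineBudget.OPT v b (Finset.univ.erase j) (m : ℝ))
    (hε' : ε' = OnlineBudget.marketEps v b (Finset.univ.erase j) (m : ℝ))
    (hpos : 0 < OPT')
    (δ : ℝ) (hδ : δ ∈ Set.Icc (0 : ℝ) (1 / 3)) :
    ENNReal.ofReal
        (max 0 (1 - 2 * Real.exp (-(1 / (16 * ε')))) *
          max 0 (1 - 4 * Real.exp (-(δ ^ 2 / (16 * ε'))))) ≤
      ProbabilityTheory.cond (OnlineBudget.drawLaw n)
        {D | D.pivot = j}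
        {D | ENNReal.ofReal ((1 - 3 * δ) * OPT' / 16) <
          OnlineBudget.expectedRevenue (OnlineBudget.revIndiv a d v b (m : ℝ) P D)} := by
  classical
  obtain ⟨K, rfl⟩ := hm
  have hmK : ((4 * K : ℕ) : ℝ) / 4 = K := by push_cast; ring
  set y := Real.exp (-(δ ^ 2 / (16 * ε'))) with hy
  -- If the second factor vanishes there is nothing to prove. Otherwise `y < 1 / 4`, which supplies
  -- the positivity of `δ` and the smallness of `ε'` needed below.
  rcases le_or_gt (1 - 4 * y) 0 with hy0 | hy0
  · rw [max_eq_left hy0]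
    simp
  obtain ⟨q, hq, hqO⟩ := OnlineBudget.exists_isOptPrice v b hb (Finset.univ.erase j)
    ((4 * K : ℕ) : ℝ) (Nat.cast_nonneg _)
  rw [← hOPT'] at hqO
  have hq0 := hq.1
  unfold OnlineBudget.uniformRevenue at hqO
  rw [min_mul_of_nonneg _ _ hq0.le, ← Finset.sum_div, div_mul_cancel₀ _ hq0.ne'] at hqO
  have hOb := hqO.ge.trans (min_le_left _ _)
  have hqK : OPT' / 4 ≤ K * q := by
    have := hqO.ge.trans (min_le_right _ _)
    push_cast at this
    linarith
  obtain ⟨c, hc0, hcj, hcb, hcO⟩ := OnlineBudget.exists_weights hb j hpos hOb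
  have hcb' : ∀ i, c i ≤ b i := fun i => (hcb i).trans (by split_ifs; exacts [le_rfl, hb i])
  have hmax : ε' * OPT' = OnlineBudget.maxBudget b (Finset.univ.erase j) := by
    rw [hε', OnlineBudget.marketEps, ← hOPT', div_mul_cancel₀ _ hpos.ne']
  have hbε : ∀ i, i ≠ j → b i ≤ ε' * OPT' := by
    intro i hi
    rw [hmax]
    exact le_csSup ((Finset.finite_toSet _).image b).bddAbove ⟨i, by simp [hi], rfl⟩
  have hε0 : 0 < ε' := by
    obtain ⟨i, -, hi⟩ := Finset.exists_ne_zero_of_sum_ne_zero (hcO.trans_ne hpos.ne')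
    have hij : i ≠ j := by
      rintro rfl
      exact hi hcj
    have h1 : 0 < c i := lt_of_le_of_ne (hc0 i) (Ne.symm hi)
    exact pos_of_mul_pos_left (h1.trans_le ((hcb' i).trans (hbε i hij))) hpos.le
  -- From `1 - x ≤ exp (-x) < 1 / 4`.
  have hx : 3 / 4 < δ ^ 2 / (16 * ε') := by
    have := Real.add_one_le_exp (-(δ ^ 2 / (16 * ε')))
    rw [← hy] at this
    linarith
  have hδ0 : 0 < δ := by
    rcases hδ.1.eq_or_lt with h | h
    · rw [← h] at hx
      norm_num at hx
    · exact h
  have hε1 : ε' ≤ 3 / 16 := by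
    rw [lt_div_iff₀ (by positivity)] at hx
    nlinarith [hδ.2]
  have hE := OnlineBudget.card_draws_mul_card_colourings j
    (OnlineBudget.Balanced v b P j c (OPT' / 4 - 3 * δ * OPT' / 16) (δ * √(OPT' / 8)))
  have hcount := OnlineBudget.le_card_balanced v b hb P j hc0 hcj hcb' hcO hpos hε0 hbε hδ.1
  rw [OnlineBudget.cond_drawLaw_pivot]
  set Z := (Finset.univ.filter fun D : OnlineBudget.Draw n => D.pivot = j) with hZ
  set X := Z.filter fun D => OnlineBudget.Balanced v b P j c (OPT' / 4 - 3 * δ * OPT' / 16)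
    (δ * √(OPT' / 8)) (D.before, D.sideOf) with hX
  have hZ0 : 0 < Z.card := OnlineBudget.card_pivot_eq_pos j
  -- Transfers the count of balanced colourings to the draws with pivot `j`.
  have hXZ : (1 - 4 * y) * Z.card ≤ X.card := by
    have hN : (0 : ℝ) < Fintype.card ((Fin (n + 1) → Bool) × (Fin (n + 1) → Bool)) := by
      exact_mod_cast Fintype.card_pos
    refine le_of_mul_le_mul_right ?_ hN
    have hE' := congrArg (Nat.cast : ℕ → ℝ) hE
    rw [Nat.cast_mul, Nat.cast_mul] at hE'
    rw [hE', mul_right_comm, mul_comm]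
    gcongr
  have hsub : X.card ≤ (Z.filter fun D => D ∈ {D | ENNReal.ofReal ((1 - 3 * δ) * OPT' / 16) <
      OnlineBudget.expectedRevenue
        (OnlineBudget.revIndiv a d v b ((4 * K : ℕ) : ℝ) P D)}).card := by
    refine Finset.card_le_card fun D hD => ?_
    rw [hX, Finset.mem_filter] at hD
    refine Finset.mem_filter.2 ⟨hD.1, ?_⟩
    have hDj : D.pivot = j := (Finset.mem_filter.1 hD.1).2
    subst hDj
    exact OnlineBudget.lt_expectedRevenue_of_balanced hb hmK hP a d hpos hq0 hqK hcb hδ0 hδ.2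
      hε1 D hbε hD.2
  rw [ENNReal.le_div_iff_mul_le (Or.inl (by exact_mod_cast hZ0.ne')) (Or.inl (by simp))]
  refine le_trans ?_ (Nat.cast_le.2 hsub)
  have hfac : max 0 (1 - 2 * Real.exp (-(1 / (16 * ε')))) * max 0 (1 - 4 * y) ≤ 1 - 4 * y := by
    rw [max_eq_right hy0.le]
    refine mul_le_of_le_one_left hy0.le (max_le zero_le_one ?_)
    linarith [Real.exp_pos (-(1 / (16 * ε')))]
  calc _ ≤ ENNReal.ofReal (1 - 4 * y) * Z.card := by gcongr
    _ = ENNReal.ofReal ((1 - 4 * y) * Z.card) := by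
        rw [ENNReal.ofReal_mul hy0.le, ENNReal.ofReal_natCast]
    _ ≤ ENNReal.ofReal X.card := ENNReal.ofReal_le_ofReal hXZ
    _ = X.card := ENNReal.ofReal_natCast _
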